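/- All objects are $C^\infty$; manifolds are finite-dimensional, Hausdorff, second countable and without boundary. A \emph{system} $(M,I;\tau)$ consists of a manifold $M$, a vector subbundle $I\subset T^*M$ of constant rank and a $1$-form $\tau$ on $M$ with $\tau_p\notin I_p$ for all $p\in M$, such that (i) $(M,I)$ admits no Cauchy characteristics: there is no nowhere vanishing vector field $X$, on any nonempty open set $U\subset M$, with $\theta(X)=0$ and $X\lrcorner\, d\theta\in I$ (at every point where $\theta$ is defined) for all local sections $\theta$ of $I$ over open subsets of $U$; (ii) $\tau=df$ for some smooth function $f$ on $M$; (iii) there is no immersion $\iota:S\to M$ of a nonempty surface $S$ with $\iota^*I=0$ and $\iota^*\tau$ nowhere zero. Let $(M,I;\tau)$ be a system and let $\mu^\alpha\in\Omega^1(M)$, $\alpha\in\mathcal S$ ($\mathcal S$ a finite set), be pointwise linearly independent modulo $I$ and $\tau$. Put $N:=M\times\mathbb R^{\mathcal S}$, with coordinates $(\lambda^\alpha)_{\alpha\in\mathcal S}$ on the second factor, and let $J\subset T^*N$ be generated by (the pullbacks of) $I$ and the $1$-forms $\mu^\alpha-\lambda^\alpha\tau$, $\alpha\in\mathcal S$ (a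 \emph{partial prolongation} of $(M,I;\tau)$). \textbf{Proposition.} $(N,J;\tau)$, with $\tau$ pulled back to $N$, is again a system: $J$ is a subbundle of rank $\operatorname{rank}(I)+|\mathcal S|$, $\tau$ is exact and nowhere in $J$, $(N,J)$ has no Cauchy characteristics, and it has no integral surfaces on which $\tau$ is nonzero. Moreover, every nonempty open subset of $N$ contains a nonempty open subset on which $J$ and all its iterated derived systems have constant ranks. (Here the derived system of a field $P$ of subspaces of the cotangent spaces consists at $p$ of the linear span of the values $\theta_p$ of the local sections $\theta$ of $P$ near $p$ whose differential $d\theta_p$ vanishes on pairs of vectors annihilated by $P_p$.) -/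

import Mathlib

open Set Filter Topology
open scoped Manifold ContDiff

noncomputable section

namespace PfaffianSystem

section Forms

variable {E : Type*} [NormedAddCommGroup E] [NormedSpace ℝ E]
  {H : Type*} [TopologicalSpace H] (I : ModelWithCorners ℝ E H)
  (M : Type*) [TopologicalSpace M] [ChartedSpace H M]

/-- A (not necessarily smooth) differential `1`-form on `M`. -/
abbrev OneForm : Type _ := ∀ p : M, TangentSpace I p →L[ℝ] ℝ

/-- A field of linear subspaces of the cotangent spaces of `M`. -/
abbrev CotangentField : Type _ := ∀ p : M, Submodule ℝ (TangentSpace I p →L[ℝ] ℝ)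

variable {M}

/-- The `1`-form `θ` is `C^∞` on the set `U`, as a section of the cotangent bundle. -/
def SmoothFormOn [IsManifold I ∞ M] (θ : OneForm I M) (U : Set M) : Prop :=
  ContMDiffOn I (I.prod 𝓘(ℝ, E →L[ℝ] ℝ)) ∞
    (fun p => Bundle.TotalSpace.mk' (E →L[ℝ] ℝ)
      (E := fun p : M => TangentSpace I p →L[ℝ] Bundle.Trivial M ℝ p) p (θ p)) U

/-- The vector field `X` is `C^∞` on the set `U`. -/
def SmoothFieldOn [IsManifold I ∞ M] (X : ∀ p : M, TangentSpace I p) (U : Set M) : Prop :=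
  ContMDiffOn I I.tangent ∞ (fun p => (⟨p, X p⟩ : TangentBundle I M)) U

/-- The expression of the `1`-form `θ` in the preferred chart `φ` at `p`, that is, the
pullback `(φ⁻¹)^* θ`, a `1`-form on (an open subset of) the model space `E`. -/
def chartForm (θ : OneForm I M) (p : M) (x : E) : E →L[ℝ] ℝ :=
  (θ ((extChartAt I p).symm x)).comp (mfderiv 𝓘(ℝ, E) I (extChartAt I p).symm x)

/-- The exterior derivative of a `1`-form on a manifold without boundary, computed in the
preferred chart `φ` at the point `p`: if `η = (φ⁻¹)^* θ` then
`dθ_p (v, w) = (Dη (φ_* v)) (φ_* w) - (Dη (φ_* w)) (φ_* v)`. -/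
def extDerivForm (θ : OneForm I M) (p : M) :
    TangentSpace I p →L[ℝ] TangentSpace I p →L[ℝ] ℝ :=
  let A : E →L[ℝ] E →L[ℝ] ℝ := fderiv ℝ (chartForm I θ p) (extChartAt I p p)
  let c : E →L[ℝ] E := mfderiv I 𝓘(ℝ, E) (extChartAt I p) p
  let B : E →L[ℝ] E →L[ℝ] ℝ := (A - A.flip).bilinearComp c c
  B

/-- `θ` restricts to a smooth section of `P` over the open set `U`. -/
structure IsSectionOn [IsManifold I ∞ M] (P : CotangentField I M) (θ : OneForm I M)
    (U : Set M) : Prop where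
  isOpen : IsOpen U
  smooth : SmoothFormOn I θ U
  mem : ∀ q ∈ U, θ q ∈ P q

/-- `P` is a smooth vector subbundle of rank `n` of the cotangent bundle: locally it is spanned
by `n` smooth pointwise linearly independent `1`-forms. -/
def IsSubbundle [IsManifold I ∞ M] (P : CotangentField I M) (n : ℕ) : Prop :=
  ∀ p : M, ∃ U : Set M, IsOpen U ∧ p ∈ U ∧ ∃ θ : Fin n → OneForm I M,
    (∀ i, SmoothFormOn I (θ i) U) ∧
    ∀ q ∈ U, LinearIndependent ℝ (fun i => θ i q) ∧
      Submodule.span ℝ (range fun i => θ i q) = P q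

/-- The tangent vector `v` at `p` is a Cauchy characteristic vector of the Pfaffian system `P`:
it annihilates `P`, and `v ⌟ dθ` lies in `P` for every local section `θ` of `P`. -/
def IsCauchyVector [IsManifold I ∞ M] (P : CotangentField I M) (p : M)
    (v : TangentSpace I p) : Prop :=
  (∀ α ∈ P p, α v = 0) ∧
    ∀ (θ : OneForm I M) (U : Set M), p ∈ U → IsSectionOn I P θ U → extDerivForm I θ p v ∈ P p

/-- The Pfaffian system `P` admits Cauchy characteristics: on some nonempty open set there is a
nowhere vanishing smooth vector field of Cauchy characteristic vectors (whose integral curves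
are Cauchy characteristic curves). -/
def AdmitsCauchyCharacteristics [IsManifold I ∞ M] (P : CotangentField I M) : Prop :=
  ∃ (U : Set M) (X : ∀ p : M, TangentSpace I p), IsOpen U ∧ U.Nonempty ∧ SmoothFieldOn I X U ∧
    ∀ p ∈ U, X p ≠ 0 ∧ IsCauchyVector I P p (X p)

/-- The Pfaffian system `P` admits an integral surface `j : S → M` (an immersed surface with
`j^* P = 0`) on which `j^* τ` is nowhere zero. -/
def AdmitsIntegralSurface (P : CotangentField I M) (τ : OneForm I M) : Prop :=
  ∃ (S : Type) (_ : TopologicalSpace S) (_ : ChartedSpace (EuclideanSpace ℝ (Fin 2)) S)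
    (_ : IsManifold (𝓡 2) ∞ S) (_ : T2Space S) (_ : SecondCountableTopology S) (_ : Nonempty S)
    (j : S → M), ContMDiff (𝓡 2) I ∞ j ∧
    ∀ s : S, Function.Injective (mfderiv (𝓡 2) I j s) ∧
      (∀ α ∈ P (j s), α.comp (mfderiv (𝓡 2) I j s) = 0) ∧
      (τ (j s)).comp (mfderiv (𝓡 2) I j s) ≠ 0

/-- `τ` is exact: it is the differential of a smooth function on `M`. -/
def IsExact (τ : OneForm I M) : Prop :=
  ∃ f : M → ℝ, ContMDiff I 𝓘(ℝ, ℝ) ∞ f ∧ ∀ p, τ p = mfderiv I 𝓘(ℝ, ℝ) f p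

/-- `(M, P; τ)` is a system: a Pfaffian system `P` of rank `n` with independence condition `τ`
(nowhere in `P`), such that there are no Cauchy characteristics, `τ` is exact, and there is no
integral surface on which `τ` is nonzero. -/
structure IsSystem [IsManifold I ∞ M] (P : CotangentField I M) (n : ℕ) (τ : OneForm I M) :
    Prop where
  subbundle : IsSubbundle I P n
  independence : ∀ p, τ p ∉ P p
  no_cauchy : ¬ AdmitsCauchyCharacteristics I P
  exact : IsExact I τ
  no_surface : ¬ AdmitsIntegralSurface I P τ

/-- The derived system of `P`: at `p` it consists of the values `θ p` of the local sections `θ`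
of `P` for which `dθ` vanishes at `p` modulo `P`, that is, on the annihilator of `P p`.
(Where `P` is a subbundle these values already form a linear subspace.) -/
def derivedSystem [IsManifold I ∞ M] (P : CotangentField I M) : CotangentField I M := fun p =>
  Submodule.span ℝ {α | ∃ (θ : OneForm I M) (U : Set M), p ∈ U ∧ IsSectionOn I P θ U ∧ θ p = α ∧
    ∀ v w : TangentSpace I p, (∀ η ∈ P p, η v = 0) → (∀ η ∈ P p, η w = 0) →
      extDerivForm I θ p v w = 0}

/-- `P` and all its iterated derived systems have constant ranks on the set `U`. -/
def HasConstantDerivedRanksOn [IsManifold I ∞ M] (P : CotangentField I M) (U : Set M) : Prop :=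
  ∀ k : ℕ, ∃ r : ℕ, ∀ q ∈ U, Module.finrank ℝ ((derivedSystem I)^[k] P q) = r

end Forms

section Prolongation

variable {E : Type*} [NormedAddCommGroup E] [NormedSpace ℝ E]
  {M : Type*} [TopologicalSpace M] [ChartedSpace E M]
  (A : Type*) [Fintype A]

/-- The model of the product manifold `M × ℝ^A`. -/
abbrev prolModel (E : Type*) [NormedAddCommGroup E] [NormedSpace ℝ E] (A : Type*) [Fintype A] :
    ModelWithCorners ℝ (E × (A → ℝ)) (ModelProd E (A → ℝ)) :=
  𝓘(ℝ, E).prod 𝓘(ℝ, A → ℝ)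

/-- Pullback of covectors along the projection `M × ℝ^A → M`, at the point `q`. -/
def pullCovector (q : M × (A → ℝ)) :
    (TangentSpace 𝓘(ℝ, E) q.1 →L[ℝ] ℝ) →ₗ[ℝ] (TangentSpace (prolModel E A) q →L[ℝ] ℝ) where
  toFun α := α.comp (mfderiv (prolModel E A) 𝓘(ℝ, E) Prod.fst q)
  map_add' _ _ := rfl
  map_smul' _ _ := rfl

/-- The pullback to `M × ℝ^A` of a `1`-form on `M`. -/
def pullForm (τ : OneForm 𝓘(ℝ, E) M) : OneForm (prolModel E A) (M × (A → ℝ)) :=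
  fun q => pullCovector A q (τ q.1)

variable {A}

/-- The Pfaffian system on `M × ℝ^A` generated by `P` and the `1`-forms `μ^a - λ^a τ`,
where `λ^a` are the coordinates on the factor `ℝ^A`. -/
def partialProlongation (P : CotangentField 𝓘(ℝ, E) M) (τ : OneForm 𝓘(ℝ, E) M)
    (μ : A → OneForm 𝓘(ℝ, E) M) : CotangentField (prolModel E A) (M × (A → ℝ)) := fun q =>
  (P q.1).map (pullCovector A q) ⊔
    Submodule.span ℝ (range fun a => pullForm A (μ a) q - q.2 a • pullForm A τ q)

/-- The forms `μ^a` are pointwise linearly independent modulo `P` and `τ`. -/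
def IndependentModulo (P : CotangentField 𝓘(ℝ, E) M) (τ : OneForm 𝓘(ℝ, E) M)
    (μ : A → OneForm 𝓘(ℝ, E) M) : Prop :=
  ∀ p, LinearIndependent ℝ (fun a => (P p ⊔ Submodule.span ℝ {τ p}).mkQ (μ a p))

end Prolongation

end PfaffianSystem

end

noncomputable section

namespace PfaffianSystem

set_option linter.unusedSectionVars false

section Calculus

variable {E F : Type*} [NormedAddCommGroup E] [NormedSpace ℝ E]
  [NormedAddCommGroup F] [NormedSpace ℝ F]

/-- The exterior derivative of a `1`-form on a normed space. -/
def extD (η : E → E →L[ℝ] ℝ) (x : E) : E →L[ℝ] E →L[ℝ] ℝ :=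
  fderiv ℝ η x - (fderiv ℝ η x).flip

lemma extD_apply (η : E → E →L[ℝ] ℝ) (x v w : E) :
    extD η x v w = fderiv ℝ η x v w - fderiv ℝ η x w v := rfl

lemma extD_congr {η η' : E → E →L[ℝ] ℝ} {x : E} (h : η =ᶠ[𝓝 x] η') : extD η x = extD η' x := by
  simp only [extD, h.fderiv_eq]

lemma extD_pullback {φ : E → F} {η : F → F →L[ℝ] ℝ} {x : E} (hφ : ContDiffAt ℝ 2 φ x)
    (hη : DifferentiableAt ℝ η (φ x)) (v w : E) :
    extD (fun y => (η (φ y)).comp (fderiv ℝ φ y)) x v w =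
      extD η (φ x) (fderiv ℝ φ x v) (fderiv ℝ φ x w) := by
  have h1 : DifferentiableAt ℝ φ x := hφ.differentiableAt (by norm_num)
  have h2 : DifferentiableAt ℝ (fderiv ℝ φ) x :=
    (hφ.fderiv_right (m := 1) (by norm_num)).differentiableAt (by norm_num)
  have h3 : HasFDerivAt (fun y => η (φ y)) ((fderiv ℝ η (φ x)).comp (fderiv ℝ φ x)) x :=
    hη.hasFDerivAt.comp x h1.hasFDerivAt
  have h4 := h3.clm_comp h2.hasFDerivAt
  have hs : fderiv ℝ (fderiv ℝ φ) x v w = fderiv ℝ (fderiv ℝ φ) x w v :=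
    (hφ.isSymmSndFDerivAt (by simp)).eq v w
  simp only [extD_apply, h4.fderiv]
  simp [hs]

lemma extD_smul {f : E → ℝ} {η : E → E →L[ℝ] ℝ} {x : E} (hf : DifferentiableAt ℝ f x)
    (hη : DifferentiableAt ℝ η x) (v w : E) :
    extD (fun y => f y • η y) x v w =
      f x * extD η x v w + (fderiv ℝ f x v * η x w - fderiv ℝ f x w * η x v) := by
  simp only [extD_apply, fderiv_fun_smul hf hη]
  simp
  ring

lemma extD_add {η η' : E → E →L[ℝ] ℝ} {x : E} (h : DifferentiableAt ℝ η x)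
    (h' : DifferentiableAt ℝ η' x) : extD (fun y => η y + η' y) x = extD η x + extD η' x := by
  ext v w
  simp only [extD_apply, fderiv_fun_add h h']
  simp [extD_apply]
  ring

lemma extD_sum {ι : Type*} {s : Finset ι} {η : ι → E → E →L[ℝ] ℝ} {x : E}
    (h : ∀ i ∈ s, DifferentiableAt ℝ (η i) x) (v w : E) :
    extD (fun y => ∑ i ∈ s, η i y) x v w = ∑ i ∈ s, extD (η i) x v w := by
  simp [extD_apply, fderiv_fun_sum h]

lemma contDiffOn_extD {η : E → E →L[ℝ] ℝ} {U : Set E} (hU : IsOpen U)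
    (h : ContDiffOn ℝ ∞ η U) : ContDiffOn ℝ ∞ (extD η) U := by
  have h1 : ContDiffOn ℝ ∞ (fderiv ℝ η) U := h.fderiv_of_isOpen hU (by simp)
  have h2 : ContDiff ℝ ∞ (fun B : E →L[ℝ] E →L[ℝ] ℝ => B.flip) :=
    IsBoundedLinearMap.contDiff ⟨⟨fun _ _ => rfl, fun _ _ => rfl⟩, 1, one_pos,
      fun B => (B.opNorm_flip.trans (one_mul _).symm).le⟩
  exact h1.sub (h2.comp_contDiffOn h1)

end Calculus

section Families

variable {X V F G : Type*} [NormedAddCommGroup X] [NormedSpace ℝ X]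
  [NormedAddCommGroup V] [NormedSpace ℝ V]
  [NormedAddCommGroup F] [NormedSpace ℝ F] [FiniteDimensional ℝ F]
  [NormedAddCommGroup G] [NormedSpace ℝ G] [FiniteDimensional ℝ G]

/-- A smooth family of linear maps that is onto at a point has locally a smooth right inverse. -/
lemma exists_smooth_rightInverse {Θ : X → V →L[ℝ] F} {Ω : Set X} (hΩ : IsOpen Ω)
    (hΘ : ContDiffOn ℝ ∞ Θ Ω) {x₀ : X} (hx₀ : x₀ ∈ Ω) (hs : Function.Surjective (Θ x₀)) :
    ∃ O ⊆ Ω, IsOpen O ∧ x₀ ∈ O ∧ ∃ W : X → F →L[ℝ] V, ContDiffOn ℝ ∞ W O ∧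
      ∀ x ∈ O, (Θ x).comp (W x) = ContinuousLinearMap.id ℝ F := by
  have : CompleteSpace F := FiniteDimensional.complete ℝ F
  obtain ⟨R, hR⟩ := (Θ x₀).exists_rightInverse_of_surjective (LinearMap.range_eq_top.2 hs)
  let C : X → F →L[ℝ] F := fun x => (Θ x).comp R
  have hC : ContDiffOn ℝ ∞ C Ω := hΘ.clm_comp contDiffOn_const
  have hC₀ : C x₀ = 1 := hR
  refine ⟨Ω ∩ C ⁻¹' {c | IsUnit c}, inter_subset_left,
    hC.continuousOn.isOpen_inter_preimage hΩ Units.isOpen, ⟨hx₀, by simp [hC₀]⟩,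
    fun x => R.comp (Ring.inverse (C x)), ?_, ?_⟩
  · refine contDiffOn_const.clm_comp fun x hx => ?_
    obtain ⟨u, hu⟩ := hx.2
    have := contDiffAt_ringInverse ℝ (n := ∞) u
    rw [hu] at this
    exact this.comp_contDiffWithinAt x ((hC x hx.1).mono inter_subset_left)
  · intro x hx
    exact Ring.mul_inverse_cancel (C x) hx.2

/-- A smooth family of linear maps has, over some nonempty open set, kernels of constant
dimension, with a smooth frame. -/
lemma exists_kernel_frame {B : X → F →L[ℝ] G} {Ω : Set X} (hΩ : IsOpen Ω) (hne : Ω.Nonempty)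
    (hB : ContDiffOn ℝ ∞ B Ω) :
    ∃ O ⊆ Ω, IsOpen O ∧ O.Nonempty ∧ ∃ (m : ℕ) (k : Fin m → X → F),
      (∀ i, ContDiffOn ℝ ∞ (k i) O) ∧ ∀ x ∈ O, LinearIndependent ℝ (fun i => k i x) ∧
        Submodule.span ℝ (range fun i => k i x) = LinearMap.ker (B x).toLinearMap := by
  classical
  let d : X → ℕ := fun x => Module.finrank ℝ (LinearMap.ker (B x).toLinearMap)
  obtain ⟨x₁, hx₁, hmin⟩ : ∃ x₁ ∈ Ω, ∀ x ∈ Ω, d x₁ ≤ d x := by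
    have hex : ∃ m, ∃ x ∈ Ω, d x = m := ⟨_, hne.some, hne.some_mem, rfl⟩
    obtain ⟨x₁, h1, h2⟩ := Nat.find_spec hex
    exact ⟨x₁, h1, fun x hx => h2 ▸ Nat.find_min' hex ⟨x, hx, rfl⟩⟩
  let R := LinearMap.range (B x₁).toLinearMap
  obtain ⟨p, hp⟩ := R.subtype.exists_leftInverse_of_injective (Submodule.ker_subtype R)
  let L : G →L[ℝ] R := p.toContinuousLinearMap
  have hL : ∀ y : R, L y = y := fun y => LinearMap.congr_fun hp y
  let D : X → F →L[ℝ] R := fun x => L.comp (B x)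
  have hD : ContDiffOn ℝ ∞ D Ω := contDiffOn_const.clm_comp hB
  have hs : Function.Surjective (D x₁) := by
    rintro ⟨y, z, rfl⟩
    exact ⟨z, hL ⟨B x₁ z, z, rfl⟩⟩
  have hker₁ : LinearMap.ker (D x₁).toLinearMap = LinearMap.ker (B x₁).toLinearMap := by
    ext z
    simp only [LinearMap.mem_ker]
    constructor
    · intro h
      have := hL ⟨B x₁ z, z, rfl⟩
      exact congrArg Subtype.val (this.symm.trans h)
    · intro h
      change L (B x₁ z) = 0
      have h' : B x₁ z = 0 := h
      rw [h', map_zero]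
  obtain ⟨O, hOΩ, hO, hx₁O, W, hW, hDW⟩ := exists_smooth_rightInverse hΩ hD hx₁ hs
  have hDW' : ∀ x ∈ O, ∀ y, D x (W x y) = y := fun x hx y =>
    congrArg (fun l : R →L[ℝ] R => l y) (hDW x hx)
  have hdim : ∀ x ∈ O, Module.finrank ℝ (LinearMap.ker (D x).toLinearMap) = d x₁ := by
    intro x hx
    have h1 := LinearMap.finrank_range_add_finrank_ker (D x).toLinearMap
    have h2 := LinearMap.finrank_range_add_finrank_ker (B x₁).toLinearMap
    have h3 : LinearMap.range (D x).toLinearMap = ⊤ :=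
      LinearMap.range_eq_top.2 fun y => ⟨W x y, hDW' x hx y⟩
    rw [h3, finrank_top] at h1
    have h4 : Module.finrank ℝ R = Module.finrank ℝ (LinearMap.range (B x₁).toLinearMap) := rfl
    change _ = Module.finrank ℝ (LinearMap.ker (B x₁).toLinearMap)
    omega
  have hker : ∀ x ∈ O, LinearMap.ker (B x).toLinearMap = LinearMap.ker (D x).toLinearMap := by
    intro x hx
    refine Submodule.eq_of_le_of_finrank_le (fun z hz => ?_) ?_
    · have hz' : B x z = 0 := hz
      change L (B x z) = 0
      rw [hz', map_zero]
    · rw [hdim x hx]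
      exact hmin x (hOΩ hx)
  let b := Module.finBasis ℝ (LinearMap.ker (B x₁).toLinearMap)
  let k : Fin (d x₁) → X → F := fun i x => (b i : F) - W x (D x (b i))
  have hk : ∀ i, ContDiffOn ℝ ∞ (k i) O := fun i =>
    contDiffOn_const.sub (hW.clm_apply ((hD.mono hOΩ).clm_apply contDiffOn_const))
  have hkmem : ∀ x ∈ O, ∀ i, k i x ∈ LinearMap.ker (D x).toLinearMap := by
    intro x hx i
    change D x (_ - _) = 0
    rw [map_sub, hDW' x hx, sub_self]
  have hk₁ : (fun i => k i x₁) = fun i => (b i : F) := by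
    funext i
    have : D x₁ (b i) = 0 := hker₁.ge (b i).2
    simp [k, this]
  have hkc : ContinuousOn (fun x i => k i x) O :=
    continuousOn_pi.2 fun i => (hk i).continuousOn
  refine ⟨O ∩ (fun x i => k i x) ⁻¹' {f | LinearIndependent ℝ f},
    inter_subset_left.trans hOΩ, hkc.isOpen_inter_preimage hO isOpen_setOfPred_linearIndependent,
    ⟨x₁, hx₁O, ?_⟩, d x₁, k, fun i => (hk i).mono inter_subset_left, fun x hx => ⟨hx.2, ?_⟩⟩
  · change LinearIndependent ℝ (fun i => k i x₁)
    rw [hk₁]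
    exact b.linearIndependent.map' _ (Submodule.ker_subtype _)
  · rw [hker x hx.1]
    refine Submodule.eq_of_le_of_finrank_eq ?_ ?_
    · rw [Submodule.span_le]
      rintro _ ⟨i, rfl⟩
      exact hkmem x hx.1 i
    · rw [hdim x hx.1]
      exact (finrank_span_eq_card hx.2).trans (by simp)

end Families

section Superposition

universe u

variable {K : Type*} [TopologicalSpace K] [CompactSpace K]

/-- Pointwise evaluation of a continuous family of linear maps on a continuous function. -/
def pointwiseApply (K : Type*) [TopologicalSpace K] [CompactSpace K] (E F : Type*)
    [NormedAddCommGroup E] [NormedSpace ℝ E] [NormedAddCommGroup F] [NormedSpace ℝ F] :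
    C(K, E →L[ℝ] F) →L[ℝ] C(K, E) →L[ℝ] C(K, F) :=
  LinearMap.mkContinuous₂
    (LinearMap.mk₂ ℝ (fun (A : C(K, E →L[ℝ] F)) (h : C(K, E)) =>
      (⟨fun t => A t (h t), A.continuous.clm_apply h.continuous⟩ : C(K, F)))
      (fun A A' h => by ext; simp) (fun c A h => by ext; simp)
      (fun A h h' => by ext; simp) (fun c A h => by ext; simp)) 1
    (fun A h => by
      refine (ContinuousMap.norm_le _ (by positivity)).2 fun t => ?_
      rw [one_mul]
      exact ((A t).le_opNorm (h t)).trans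
        (by gcongr; exacts [A.norm_coe_le_norm t, h.norm_coe_le_norm t]))

variable {E F : Type u} [NormedAddCommGroup E] [NormedSpace ℝ E]
  [NormedAddCommGroup F] [NormedSpace ℝ F]

lemma hasFDerivAt_superposition (f : C(E, F)) (hf : Differentiable ℝ f) (f' : C(E, E →L[ℝ] F))
    (hf' : ∀ x, f' x = fderiv ℝ f x) (u : C(K, E)) :
    HasFDerivAt (fun u : C(K, E) => f.comp u) (pointwiseApply K E F (f'.comp u)) u := by
  rw [hasFDerivAt_iff_isLittleO_nhds_zero, Asymptotics.isLittleO_iff]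
  intro c hc
  have hcont : ContinuousAt (fun u : C(K, E) => f'.comp u) u :=
    (ContinuousMap.continuous_postcomp f').continuousAt
  obtain ⟨δ, hδ, H⟩ := Metric.eventually_nhds_iff.1
    (hcont.eventually (Metric.ball_mem_nhds (f'.comp u) hc))
  have key : ∀ t, ∀ y ∈ Metric.ball (u t) δ, ‖fderiv ℝ f y - f' (u t)‖ ≤ c := by
    intro t y hy
    have h1 := H (y := u + ContinuousMap.const K (y - u t)) (by
      rw [dist_eq_norm, add_sub_cancel_left]
      refine (ContinuousMap.norm_lt_iff _ hδ).2 fun _ => ?_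
      simpa [dist_eq_norm] using hy)
    have h2 := (ContinuousMap.dist_apply_le_dist t).trans (Metric.mem_ball.1 h1).le
    rw [dist_eq_norm] at h2
    simpa [hf'] using h2
  filter_upwards [Metric.ball_mem_nhds (0 : C(K, E)) hδ] with h hh
  refine (ContinuousMap.norm_le _ (by positivity)).2 fun t => ?_
  have hht : ‖h t‖ < δ := (h.norm_coe_le_norm t).trans_lt (by simpa using hh)
  have := (convex_ball (u t) δ).norm_image_sub_le_of_norm_hasFDerivWithin_le'
    (fun y _ => (hf y).hasFDerivAt.hasFDerivWithinAt) (key t) (Metric.mem_ball_self hδ)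
    (show u t + h t ∈ Metric.ball (u t) δ by simpa using hht)
  rw [add_sub_cancel_left] at this
  exact this.trans (mul_le_mul_of_nonneg_left (h.norm_coe_le_norm t) hc.le)

lemma contDiff_superposition_nat (n : ℕ) : ∀ {F : Type u} [NormedAddCommGroup F]
    [NormedSpace ℝ F] (f : C(E, F)), ContDiff ℝ n f →
    ContDiff ℝ n (fun u : C(K, E) => f.comp u) := by
  induction n with
  | zero =>
    intro F _ _ f _
    exact contDiff_zero.2 (ContinuousMap.continuous_postcomp f)
  | succ n ih =>
    intro F _ _ f hf
    have hf1 : ContDiff ℝ n (fderiv ℝ f) := hf.fderiv_right (by simp)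
    let f' : C(E, E →L[ℝ] F) := ⟨fderiv ℝ f, hf1.continuous⟩
    rw [Nat.cast_add, Nat.cast_one, contDiff_succ_iff_hasFDerivAt]
    exact ⟨_, (pointwiseApply K E F).contDiff.comp (ih f' hf1),
      hasFDerivAt_superposition f (hf.differentiable (by simp)) f' fun _ => rfl⟩

/-- The superposition operator of a smooth map is smooth. -/
lemma contDiff_superposition (f : C(E, F)) (hf : ContDiff ℝ ∞ f) :
    ContDiff ℝ ∞ (fun u : C(K, E) => f.comp u) :=
  contDiff_infty.2 fun n => contDiff_superposition_nat n f (hf.of_le (by exact_mod_cast le_top))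

end Superposition

section Flow

universe u

variable {E : Type u} [NormedAddCommGroup E] [NormedSpace ℝ E]

/-- Constant functions on the unit interval. -/
def constPath (E : Type*) [NormedAddCommGroup E] [NormedSpace ℝ E] : E →L[ℝ] C(Icc (0 : ℝ) 1, E) :=
  LinearMap.mkContinuous ⟨⟨ContinuousMap.const _, fun _ _ => rfl⟩, fun _ _ => rfl⟩ 1
    fun x => (ContinuousMap.norm_le _ (by positivity)).2 fun t => (one_mul ‖x‖).ge

/-- Integration from `0` of functions on the unit interval. -/
def integralPath (E : Type*) [NormedAddCommGroup E] [NormedSpace ℝ E] :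
    C(Icc (0 : ℝ) 1, E) →L[ℝ] C(Icc (0 : ℝ) 1, E) :=
  LinearMap.mkContinuous
    ⟨⟨fun u => ⟨fun t => ∫ s in (0 : ℝ)..t, u.IccExtend zero_le_one s,
        (intervalIntegral.continuous_primitive
          (fun a b => (u.IccExtend zero_le_one).continuous.intervalIntegrable a b) 0).comp
          continuous_subtype_val⟩,
      fun u v => by
        ext t
        exact intervalIntegral.integral_add ((u.IccExtend zero_le_one).continuous.intervalIntegrable _ _)
          ((v.IccExtend zero_le_one).continuous.intervalIntegrable _ _)⟩,
      fun c u => by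
        ext t
        exact intervalIntegral.integral_smul c _⟩ 1
    fun u => (ContinuousMap.norm_le _ (by positivity)).2 fun t => by
      refine (intervalIntegral.norm_integral_le_of_norm_le_const (C := ‖u‖)
        fun s _ => u.norm_coe_le_norm _).trans ?_
      rw [sub_zero, abs_of_nonneg t.2.1, mul_comm]
      exact mul_le_mul_of_nonneg_right t.2.2 (norm_nonneg _)

variable [CompleteSpace E]

/-- A smooth map with invertible derivative at a point has a smooth local right inverse. -/
lemma exists_smooth_localInverse {Y : Type*} [NormedAddCommGroup Y] [NormedSpace ℝ Y]
    [CompleteSpace Y] {Γ : Y → Y} (hΓ : ContDiff ℝ ∞ Γ) {z₀ : Y} {e : Y ≃L[ℝ] Y}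
    (he : HasFDerivAt Γ (e : Y →L[ℝ] Y) z₀) :
    ∃ inv : Y → Y, ∀ᶠ y in 𝓝 (Γ z₀), ContDiffAt ℝ ∞ inv y ∧ Γ (inv y) = y := by
  let h := hΓ.contDiffAt.toOpenPartialHomeomorph Γ he (n := ∞) (by simp)
  have hz₀ : z₀ ∈ h.source := ContDiffAt.mem_toOpenPartialHomeomorph_source _ he (by simp)
  have hy₀ : Γ z₀ ∈ h.target := h.map_source hz₀
  have h1 : ∀ᶠ y in 𝓝 (Γ z₀), fderiv ℝ Γ (h.symm y) ∈ range ((↑) : (Y ≃L[ℝ] Y) → Y →L[ℝ] Y) := by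
    refine ((hΓ.continuous_fderiv (by simp)).continuousAt.comp
      (h.continuousAt_symm hy₀)).eventually_mem ?_
    have : h.symm (Γ z₀) = z₀ := h.left_inv hz₀
    rw [Function.comp_apply, this, he.fderiv]
    exact ContinuousLinearEquiv.nhds e
  refine ⟨h.symm, ?_⟩
  filter_upwards [h1, h.open_target.mem_nhds hy₀] with y hy hyt
  obtain ⟨e', he'⟩ := hy
  refine ⟨h.contDiffAt_symm (f₀' := e') hyt ?_ hΓ.contDiffAt, h.right_inv hyt⟩
  rw [he']
  exact (hΓ.differentiable (by simp) _).hasFDerivAt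

/-- The integral equations `u = x + ε ∫ X(u)` have solutions depending smoothly on `(x, ε)`. -/
lemma exists_smooth_path (X : C(E, E)) (hX : ContDiff ℝ ∞ X) (x₀ : E) :
    ∃ u : E × ℝ → C(Icc (0 : ℝ) 1, E), ∀ᶠ z in 𝓝 (x₀, (0 : ℝ)), ContDiffAt ℝ ∞ u z ∧
      u z = constPath E z.1 + z.2 • integralPath E (X.comp (u z)) := by
  let S := C(Icc (0 : ℝ) 1, E)
  let N : S → S := fun u => X.comp u
  have hN : ContDiff ℝ ∞ N := contDiff_superposition X hX
  let Q : E × ℝ × S → S := fun z => constPath E z.1 + z.2.1 • integralPath E (N z.2.2)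
  let Γ : E × ℝ × S → E × ℝ × S := fun z => (z.1, z.2.1, z.2.2 - Q z)
  have hΓ : ContDiff ℝ ∞ Γ := by
    refine contDiff_fst.prodMk (contDiff_snd.fst.prodMk (contDiff_snd.snd.sub
      (((constPath E).contDiff.comp contDiff_fst).add (contDiff_snd.fst.smul
        ((integralPath E).contDiff.comp (hN.comp contDiff_snd.snd))))))
  let z₀ : E × ℝ × S := (x₀, 0, constPath E x₀)
  let c : S := integralPath E (N (constPath E x₀))
  let p₁ : E × ℝ × S →L[ℝ] E := ContinuousLinearMap.fst ℝ E (ℝ × S)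
  let p₂ : E × ℝ × S →L[ℝ] ℝ :=
    (ContinuousLinearMap.fst ℝ ℝ S).comp (ContinuousLinearMap.snd ℝ E (ℝ × S))
  let p₃ : E × ℝ × S →L[ℝ] S :=
    (ContinuousLinearMap.snd ℝ ℝ S).comp (ContinuousLinearMap.snd ℝ E (ℝ × S))
  let q : E × ℝ × S →L[ℝ] S := (constPath E).comp p₁ + p₂.smulRight c
  have hQ : HasFDerivAt Q q z₀ := by
    have h1 : HasFDerivAt (fun z : E × ℝ × S => constPath E z.1) ((constPath E).comp p₁) z₀ :=
      ((constPath E).comp p₁).hasFDerivAt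
    have h2 : HasFDerivAt (fun z : E × ℝ × S => z.2.1) p₂ z₀ := p₂.hasFDerivAt
    have h3 : DifferentiableAt ℝ (fun z : E × ℝ × S => integralPath E (N z.2.2)) z₀ :=
      ((integralPath E).contDiff.comp (hN.comp contDiff_snd.snd)).contDiffAt.differentiableAt
        (by simp)
    have h4 := h1.add (h2.smul h3.hasFDerivAt)
    refine h4.congr_fderiv ?_
    simp [q, z₀, c]
  let e : (E × ℝ × S) ≃L[ℝ] (E × ℝ × S) := ContinuousLinearEquiv.equivOfInverse
    (p₁.prod (p₂.prod (p₃ - q))) (p₁.prod (p₂.prod (p₃ + q)))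
    (fun z => by simp [p₁, p₂, p₃, q]) (fun z => by simp [p₁, p₂, p₃, q])
  have hΓ' : HasFDerivAt Γ (e : E × ℝ × S →L[ℝ] E × ℝ × S) z₀ :=
    p₁.hasFDerivAt.prodMk (p₂.hasFDerivAt.prodMk (p₃.hasFDerivAt.sub hQ))
  have hz₀ : Γ z₀ = (x₀, 0, 0) := by simp [Γ, z₀, Q]
  obtain ⟨inv, hinv⟩ := exists_smooth_localInverse hΓ hΓ'
  rw [hz₀] at hinv
  let ι : E × ℝ → E × ℝ × S := fun z => (z.1, z.2, 0)
  have hι : ContDiff ℝ ∞ ι := contDiff_fst.prodMk (contDiff_snd.prodMk contDiff_const)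
  refine ⟨fun z => (inv (ι z)).2.2, ?_⟩
  filter_upwards [(hι.continuous.tendsto (x₀, 0)).eventually hinv] with z ⟨hz', hz⟩
  refine ⟨(ContDiffAt.comp (g := inv) z hz' hι.contDiffAt).snd.snd, ?_⟩
  have e1 : (inv (ι z)).1 = z.1 := congrArg Prod.fst hz
  have e2 : (inv (ι z)).2.1 = z.2 := congrArg (fun y => y.2.1) hz
  have e3 : (inv (ι z)).2.2 - Q (inv (ι z)) = 0 := congrArg (fun y => y.2.2) hz
  have e4 := sub_eq_zero.1 e3
  simp only [Q, e1, e2] at e4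
  exact e4

lemma hasDerivAt_path {X : C(E, E)} {x : E} {ε : ℝ} {u : C(Icc (0 : ℝ) 1, E)}
    (hu : u = constPath E x + ε • integralPath E (X.comp u)) :
    ∃ c : ℝ → E, c 0 = x ∧ (∀ t : Icc (0 : ℝ) 1, c t = u t) ∧
      ∀ t ∈ Icc (0 : ℝ) 1, HasDerivAt c (ε • X (c t)) t := by
  let c : ℝ → E := fun t => x + ε • ∫ s in (0 : ℝ)..t, (X.comp u).IccExtend zero_le_one s
  have hc : ∀ t : Icc (0 : ℝ) 1, c t = u t := fun t => by
    conv_rhs => rw [hu]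
    rfl
  refine ⟨c, by simp [c], hc, fun t ht => ?_⟩
  have hcont := ((X.comp u).IccExtend zero_le_one).continuous
  have h := (intervalIntegral.integral_hasDerivAt_right (hcont.intervalIntegrable 0 t)
    (hcont.stronglyMeasurableAtFilter _ _) hcont.continuousAt).const_smul ε |>.const_add x
  have h2 : (X.comp u).IccExtend zero_le_one t = X (c t) := by
    rw [hc ⟨t, ht⟩]
    exact congrArg (X.comp u) (projIcc_of_mem zero_le_one ht)
  rwa [h2] at h

/-- The local flow of a globally Lipschitz smooth vector field is smooth. -/
lemma exists_smooth_flow_of_lipschitz (X : C(E, E)) (hX : ContDiff ℝ ∞ X) {L : NNReal}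
    (hL : LipschitzWith L X) (x₀ : E) :
    ∃ (Φ : E × ℝ → E) (r : ℝ), 0 < r ∧ ContDiffOn ℝ ∞ Φ (Metric.ball (x₀, 0) r) ∧
      (∀ x ∈ Metric.ball x₀ r, Φ (x, 0) = x) ∧
      ∀ x ∈ Metric.ball x₀ r, ∀ t ∈ Metric.ball (0 : ℝ) r,
        HasDerivAt (fun t => Φ (x, t)) (X (Φ (x, t))) t := by
  obtain ⟨u, hu⟩ := exists_smooth_path X hX x₀
  obtain ⟨r, hr, H⟩ := Metric.eventually_nhds_iff_ball.1 hu
  have hball : ∀ {x : E} {t : ℝ}, x ∈ Metric.ball x₀ r → |t| < r → (x, t) ∈ Metric.ball (x₀, 0) r :=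
    fun hx ht => by
      rw [← ball_prod_same]
      exact ⟨hx, by simpa using ht⟩
  let ev : C(Icc (0 : ℝ) 1, E) →L[ℝ] E := ContinuousMap.evalCLM ℝ ⟨1, by simp⟩
  have hΦ : ∀ z ∈ Metric.ball (x₀, (0 : ℝ)) r, ContDiffAt ℝ ∞ (fun z => ev (u z)) z :=
    fun z hz => ev.contDiff.contDiffAt.comp z (H z hz).1
  refine ⟨fun z => ev (u z), r, hr, fun z hz => (hΦ z hz).contDiffWithinAt, fun x hx => ?_,
    fun x hx t ht => ?_⟩
  · have := (H (x, 0) (hball hx (by simpa using hr))).2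
    simp only [zero_smul, add_zero] at this
    change ev (u (x, 0)) = x
    rw [this]
    rfl
  have ht : |t| < r := by simpa using ht
  obtain ⟨ε, σ, hε, hεr, hσ, rfl⟩ : ∃ ε σ : ℝ, ε ≠ 0 ∧ |ε| < r ∧ σ ∈ Icc (0 : ℝ) 1 ∧ t = σ * ε := by
    rcases le_or_gt 0 t with h | h
    · rw [abs_of_nonneg h] at ht
      refine ⟨(t + r) / 2, t / ((t + r) / 2), by positivity, ?_, ⟨by positivity, ?_⟩, ?_⟩
      · rw [abs_of_pos (by positivity)]; linarith
      · rw [div_le_one (by positivity)]; linarith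
      · field_simp
    · rw [abs_of_neg h] at ht
      have hneg : (t - r) / 2 < 0 := by linarith
      refine ⟨(t - r) / 2, t / ((t - r) / 2), hneg.ne, ?_, ⟨?_, ?_⟩, ?_⟩
      · rw [abs_of_neg hneg]; linarith
      · exact div_nonneg_of_nonpos h.le hneg.le
      · rw [div_le_one_of_neg hneg]; linarith
      · rw [div_mul_cancel₀ _ hneg.ne]
  obtain ⟨c, hc0, hc1, hc⟩ := hasDerivAt_path (X := X) (H (x, ε) (hball hx hεr)).2
  have hscale : ∀ s ∈ Icc (0 : ℝ) 1, ev (u (x, s * ε)) = c s := by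
    intro s hs
    have hsr : |s * ε| < r := by
      rw [abs_mul, abs_of_nonneg hs.1]
      exact (mul_le_of_le_one_left (abs_nonneg _) hs.2).trans_lt hεr
    obtain ⟨d, hd0, hd1, hd⟩ := hasDerivAt_path (X := X) (H (x, s * ε) (hball hx hsr)).2
    have hcs : ∀ y ∈ Icc (0 : ℝ) 1, HasDerivAt (fun y => c (s * y)) ((s * ε) • X (c (s * y))) y := by
      intro y hy
      have := (hc (s * y) ⟨mul_nonneg hs.1 hy.1, mul_le_one₀ hs.2 hy.1 hy.2⟩).scomp y
        ((hasDerivAt_id y).const_mul s)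
      simpa [smul_smul, Function.comp_def] using this
    have heq := ODE_solution_unique (v := fun _ y => (s * ε) • X y) (a := 0) (b := 1)
      (fun _ => (lipschitzWith_smul (s * ε)).comp hL)
      (fun y hy => (hd y hy).continuousAt.continuousWithinAt)
      (fun y hy => (hd y ⟨hy.1, hy.2.le⟩).hasDerivWithinAt)
      (fun y hy => (hcs y hy).continuousAt.continuousWithinAt)
      (fun y hy => (hcs y ⟨hy.1, hy.2.le⟩).hasDerivWithinAt) (by simp [hd0, hc0])
    have h1 := heq (right_mem_Icc.2 zero_le_one)
    simp only [mul_one] at h1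
    rw [← h1]
    exact (hd1 ⟨1, by simp⟩).symm
  have hdiff : DifferentiableAt ℝ (fun t => ev (u (x, t))) (σ * ε) :=
    ((hΦ _ (hball hx ht)).differentiableAt (by simp)).comp (σ * ε)
      (differentiableAt_const x |>.prodMk differentiableAt_id)
  have h1 : HasDerivAt (fun s => ev (u (x, s * ε)))
      (ε • deriv (fun t => ev (u (x, t))) (σ * ε)) σ := by
    have := hdiff.hasDerivAt.scomp σ ((hasDerivAt_id σ).mul_const ε)
    simpa [Function.comp_def] using this
  have h2 : HasDerivWithinAt (fun s => ev (u (x, s * ε))) (ε • X (c σ)) (Icc 0 1) σ :=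
    (hc σ hσ).hasDerivWithinAt.congr hscale (hscale σ hσ)
  have h3 := (uniqueDiffOn_Icc zero_lt_one σ hσ).eq_deriv _ h1.hasDerivWithinAt h2
  have h4 := smul_right_injective E hε h3
  have h5 := hdiff.hasDerivAt
  rw [h4, ← hscale σ hσ] at h5
  exact h5

end Flow

section LocalFlow

variable {E : Type*} [NormedAddCommGroup E] [NormedSpace ℝ E] [FiniteDimensional ℝ E]

/-- The local flow of a smooth vector field is smooth. -/
lemma exists_smooth_flow {X : E → E} {Ω : Set E} (hΩ : IsOpen Ω) (hX : ContDiffOn ℝ ∞ X Ω)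
    {x₀ : E} (hx₀ : x₀ ∈ Ω) :
    ∃ (Φ : E × ℝ → E) (r : ℝ), 0 < r ∧ ContDiffOn ℝ ∞ Φ (Metric.ball (x₀, 0) r) ∧
      (∀ x ∈ Metric.ball x₀ r, Φ (x, 0) = x) ∧
      ∀ x ∈ Metric.ball x₀ r, ∀ t ∈ Metric.ball (0 : ℝ) r, Φ (x, t) ∈ Ω ∧
        HasDerivAt (fun t => Φ (x, t)) (X (Φ (x, t))) t := by
  have : CompleteSpace E := FiniteDimensional.complete ℝ E
  obtain ⟨R, hR, hRΩ⟩ := Metric.isOpen_iff.1 hΩ x₀ hx₀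
  let f : ContDiffBump x₀ := ⟨R / 4, R / 2, by positivity, by linarith⟩
  let Y : E → E := fun x => f x • X x
  have hYX : ∀ x ∈ Metric.ball x₀ (R / 4), Y x = X x := fun x hx => by
    simp [Y, f.one_of_mem_closedBall (Metric.ball_subset_closedBall hx)]
  have hY : ContDiff ℝ ∞ Y := by
    rw [contDiff_iff_contDiffAt]
    intro x
    by_cases hx : x ∈ Metric.ball x₀ R
    · exact f.contDiffAt.smul (hX.contDiffAt (hΩ.mem_nhds (hRΩ hx)))
    · have hx' : x ∈ (Metric.closedBall x₀ (R / 2))ᶜ := fun h =>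
        hx (Metric.closedBall_subset_ball (by linarith) h)
      refine (contDiffAt_const (c := (0 : E))).congr_of_eventuallyEq ?_
      filter_upwards [Metric.isClosed_closedBall.isOpen_compl.mem_nhds hx'] with y hy
      have : f y = 0 := f.zero_of_le_dist (not_le.1 fun h => hy h).le
      simp [Y, this]
  have hYc : HasCompactSupport Y := f.hasCompactSupport.smul_right
  obtain ⟨L, hL⟩ := hY.lipschitzWith_of_hasCompactSupport hYc (by simp)
  obtain ⟨Φ, r, hr, h1, h2, h3⟩ := exists_smooth_flow_of_lipschitz ⟨Y, hY.continuous⟩ hY hL x₀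
  have hΦ₀ : Φ (x₀, 0) = x₀ := h2 x₀ (Metric.mem_ball_self hr)
  have hcont : ContinuousAt Φ (x₀, 0) :=
    h1.continuousOn.continuousAt (Metric.ball_mem_nhds _ hr)
  obtain ⟨r', hr', H⟩ := Metric.eventually_nhds_iff_ball.1 (hcont.eventually
    (Metric.ball_mem_nhds (Φ (x₀, 0)) (show 0 < R / 4 by positivity)))
  rw [hΦ₀] at H
  have hmin : 0 < min r r' := lt_min hr hr'
  refine ⟨Φ, min r r', hmin, h1.mono (Metric.ball_subset_ball (min_le_left _ _)),
    fun x hx => h2 x (Metric.ball_subset_ball (min_le_left _ _) hx), fun x hx t ht => ?_⟩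
  have hxt : Φ (x, t) ∈ Metric.ball x₀ (R / 4) := by
    refine H _ (Metric.ball_subset_ball (min_le_right r r') ?_)
    rw [← ball_prod_same]
    exact ⟨hx, ht⟩
  refine ⟨hRΩ (Metric.ball_subset_ball (by linarith) hxt), ?_⟩
  rw [← hYX _ hxt]
  exact h3 x (Metric.ball_subset_ball (min_le_left _ _) hx) t
    (Metric.ball_subset_ball (min_le_left _ _) ht)

end LocalFlow

section SweptSurface

variable {E F : Type*} [NormedAddCommGroup E] [NormedSpace ℝ E]
  [NormedAddCommGroup F] [NormedSpace ℝ F]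

/-- The derivative of `Θ(∂ₛf)` along a Cauchy characteristic field `X = ∂ₜf` of `ker Θ`. -/
lemma fderiv_form_apply_of_cauchy {Ω : Set E} (hΩ : IsOpen Ω) {X : E → E}
    (hX : ContDiffOn ℝ ∞ X Ω) {Θ : E → E →L[ℝ] F} (hΘ : ContDiffOn ℝ ∞ Θ Ω)
    (hXΘ : ∀ x ∈ Ω, Θ x (X x) = 0) {f : ℝ × ℝ → E} {q : ℝ × ℝ} (hf : ContDiffAt ℝ ∞ f q)
    (hfq : f q ∈ Ω) (hfX : ∀ᶠ z in 𝓝 q, fderiv ℝ f z (0, 1) = X (f z)) :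
    fderiv ℝ (fun z => Θ (f z) (fderiv ℝ f z (1, 0))) q (0, 1) =
      fderiv ℝ Θ (f q) (X (f q)) (fderiv ℝ f q (1, 0)) -
        fderiv ℝ Θ (f q) (fderiv ℝ f q (1, 0)) (X (f q)) := by
  have dΘ : DifferentiableAt ℝ Θ (f q) :=
    (hΘ.contDiffAt (hΩ.mem_nhds hfq)).differentiableAt (by simp)
  have dX : DifferentiableAt ℝ X (f q) :=
    (hX.contDiffAt (hΩ.mem_nhds hfq)).differentiableAt (by simp)
  have df : DifferentiableAt ℝ f q := hf.differentiableAt (by simp)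
  have ddf : DifferentiableAt ℝ (fderiv ℝ f) q :=
    (hf.fderiv_right (m := ∞) (by simp)).differentiableAt (by simp)
  have h1 : HasFDerivAt (fun z => Θ (f z)) ((fderiv ℝ Θ (f q)).comp (fderiv ℝ f q)) q :=
    dΘ.hasFDerivAt.comp q df.hasFDerivAt
  have h2 : ∀ v, HasFDerivAt (fun z => fderiv ℝ f z v) ((fderiv ℝ (fderiv ℝ f) q).flip v) q :=
    fun v => by simpa using! ddf.hasFDerivAt.clm_apply (hasFDerivAt_const v q)
  have hsymm : fderiv ℝ (fderiv ℝ f) q (0, 1) (1, 0) = fderiv ℝ (fderiv ℝ f) q (1, 0) (0, 1) :=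
    (hf.isSymmSndFDerivAt (by
      rw [minSmoothness_of_isRCLikeNormedField]
      exact ENat.LEInfty.out)).eq _ _
  have h3 : (fderiv ℝ (fderiv ℝ f) q).flip (0, 1) = (fderiv ℝ X (f q)).comp (fderiv ℝ f q) :=
    ((h2 (0, 1)).congr_of_eventuallyEq (hfX.mono fun _ h => h.symm)).unique
      (dX.hasFDerivAt.comp q df.hasFDerivAt)
  have h3' := congrArg (fun l : ℝ × ℝ →L[ℝ] E => l (1, 0)) h3
  have h4 : ∀ v, fderiv ℝ Θ (f q) v (X (f q)) + Θ (f q) (fderiv ℝ X (f q) v) = 0 := by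
    intro v
    have e1 := dΘ.hasFDerivAt.clm_apply dX.hasFDerivAt
    have e2 : HasFDerivAt (fun x => Θ x (X x)) (0 : E →L[ℝ] F) (f q) :=
      (hasFDerivAt_const (0 : F) (f q)).congr_of_eventuallyEq
        (by filter_upwards [hΩ.mem_nhds hfq] with x hx using hXΘ x hx)
    have e3 := congrArg (fun l : E →L[ℝ] F => l v) (e1.unique e2)
    simpa [add_comm] using e3
  rw [(h1.clm_apply (h2 (1, 0))).fderiv]
  have h5 := h4 (fderiv ℝ f q (1, 0))
  simp only [ContinuousLinearMap.flip_apply, ContinuousLinearMap.comp_apply] at h3'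
  simp only [add_apply, ContinuousLinearMap.comp_apply,
    ContinuousLinearMap.flip_apply, hsymm, h3', hfX.self_of_nhds]
  rw [← eq_neg_iff_add_eq_zero] at h5
  rw [h5]
  abel

variable [FiniteDimensional ℝ E] [FiniteDimensional ℝ F]

/-- The surface swept by an integral curve of `ker Θ` under the flow of a Cauchy characteristic
vector field is an integral surface of `ker Θ`. -/
lemma exists_swept_surface {Ω : Set E} (hΩ : IsOpen Ω) {x₀ : E} (hx₀ : x₀ ∈ Ω) {X : E → E}
    (hX : ContDiffOn ℝ ∞ X Ω) {Θ : E → E →L[ℝ] F} (hΘ : ContDiffOn ℝ ∞ Θ Ω)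
    (hs : Function.Surjective (Θ x₀)) (hXΘ : ∀ x ∈ Ω, Θ x (X x) = 0)
    (hC : ∀ x ∈ Ω, ∀ v, Θ x v = 0 → fderiv ℝ Θ x (X x) v - fderiv ℝ Θ x v (X x) = 0)
    {w : E} (hw : Θ x₀ w = 0) :
    ∃ (f : ℝ × ℝ → E) (r : ℝ), 0 < r ∧ ContDiffOn ℝ ∞ f (Metric.ball 0 r) ∧ f 0 = x₀ ∧
      fderiv ℝ f 0 (1, 0) = w ∧ ∀ z ∈ Metric.ball 0 r, f z ∈ Ω ∧
        fderiv ℝ f z (0, 1) = X (f z) ∧ (Θ (f z)).comp (fderiv ℝ f z) = 0 := by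
  obtain ⟨O, hOΩ, hO, hx₀O, W, hW, hΘW⟩ := exists_smooth_rightInverse hΩ hΘ hx₀ hs
  have hΘW' : ∀ x ∈ O, ∀ y, Θ x (W x y) = y := fun x hx y =>
    congrArg (fun l : F →L[ℝ] F => l y) (hΘW x hx)
  let A : E → F →L[ℝ] F := fun x =>
    (fderiv ℝ Θ x (X x) - (fderiv ℝ Θ x).flip (X x)).comp (W x)
  have hdΘ : ContinuousOn (fderiv ℝ Θ) Ω := hΘ.continuousOn_fderiv_of_isOpen hΩ (by simp)
  have hA : ContinuousOn A O := by
    have h1 : ContinuousOn (fun x => fderiv ℝ Θ x (X x)) Ω := hdΘ.clm_apply hX.continuousOn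
    have h2 : ContinuousOn (fun x => (fderiv ℝ Θ x).flip (X x)) Ω :=
      ((ContinuousLinearMap.flipₗᵢ ℝ E E F).continuous.comp_continuousOn hdΘ).clm_apply
        hX.continuousOn
    exact ((h1.sub h2).mono hOΩ).clm_comp hW.continuousOn
  have hAeq : ∀ x ∈ O, ∀ v, fderiv ℝ Θ x (X x) v - fderiv ℝ Θ x v (X x) = A x (Θ x v) := by
    intro x hx v
    have h1 : Θ x (v - W x (Θ x v)) = 0 := by rw [map_sub, hΘW' x hx, sub_self]
    have h2 := hC x (hOΩ hx) _ h1
    simp only [map_sub, sub_apply] at h2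
    simp only [A, ContinuousLinearMap.comp_apply, sub_apply,
      ContinuousLinearMap.flip_apply]
    rw [← sub_eq_zero, ← h2]
    abel
  let K : NNReal := ‖A x₀‖₊ + 1
  let O' : Set E := O ∩ (fun x => ‖A x‖₊) ⁻¹' Iio K
  have hO' : IsOpen O' := hA.nnnorm.isOpen_inter_preimage hO isOpen_Iio
  have hx₀O' : x₀ ∈ O' := ⟨hx₀O, by simp [K]⟩
  let Z : E → E := fun x => w - W x (Θ x w)
  have hZ : ContDiffOn ℝ ∞ Z O :=
    contDiffOn_const.sub (hW.clm_apply ((hΘ.mono hOΩ).clm_apply contDiffOn_const))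
  obtain ⟨Φ, r, hr, hΦ, hΦ0, hΦX⟩ :=
    exists_smooth_flow hO' (hX.mono (inter_subset_left.trans hOΩ)) hx₀O'
  obtain ⟨Ψ, ρ, hρ, hΨ, hΨ0, hΨZ⟩ := exists_smooth_flow hO hZ hx₀O
  have hx₀ρ : x₀ ∈ Metric.ball x₀ ρ := Metric.mem_ball_self hρ
  let γ : ℝ → E := fun s => Ψ (x₀, s)
  have hγ : ContDiffOn ℝ ∞ γ (Metric.ball 0 ρ) := by
    refine hΨ.comp (contDiff_prodMk_right x₀).contDiffOn fun s hs => ?_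
    rw [← ball_prod_same]
    exact ⟨hx₀ρ, hs⟩
  have hγ0 : γ 0 = x₀ := hΨ0 x₀ hx₀ρ
  obtain ⟨δ, hδ, Hδ⟩ : ∃ δ > 0, ∀ s ∈ Metric.ball (0 : ℝ) δ,
      s ∈ Metric.ball (0 : ℝ) ρ ∧ γ s ∈ Metric.ball x₀ r := by
    refine Metric.eventually_nhds_iff_ball.1 (Filter.Eventually.and (Metric.ball_mem_nhds 0 hρ) ?_)
    have := (hγ.continuousOn.continuousAt (Metric.ball_mem_nhds 0 hρ)).eventually
      (Metric.ball_mem_nhds (γ 0) hr)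
    rwa [hγ0] at this
  let f : ℝ × ℝ → E := fun z => Φ (γ z.1, z.2)
  let R := min δ r
  have hR : 0 < R := lt_min hδ hr
  have hmem : ∀ z ∈ Metric.ball (0 : ℝ × ℝ) R, z.1 ∈ Metric.ball (0 : ℝ) δ ∧
      z.2 ∈ Metric.ball (0 : ℝ) r := by
    intro z hz
    have hz' : z ∈ Metric.ball (0 : ℝ) R ×ˢ Metric.ball (0 : ℝ) R := by
      rw [ball_prod_same]
      exact hz
    exact ⟨Metric.ball_subset_ball (min_le_left _ _) hz'.1,
      Metric.ball_subset_ball (min_le_right _ _) hz'.2⟩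
  have hf : ContDiffOn ℝ ∞ f (Metric.ball 0 R) := by
    refine hΦ.comp ((hγ.comp contDiffOn_fst fun z hz => (Hδ _ (hmem z hz).1).1).prodMk
      contDiffOn_snd) fun z hz => ?_
    rw [← ball_prod_same]
    exact ⟨(Hδ _ (hmem z hz).1).2, (hmem z hz).2⟩
  have hfat : ∀ z ∈ Metric.ball (0 : ℝ × ℝ) R, ContDiffAt ℝ ∞ f z := fun z hz =>
    hf.contDiffAt (Metric.isOpen_ball.mem_nhds hz)
  have hfd : ∀ z ∈ Metric.ball (0 : ℝ × ℝ) R, HasFDerivAt f (fderiv ℝ f z) z := fun z hz =>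
    ((hfat z hz).differentiableAt (by simp)).hasFDerivAt
  have hfO : ∀ z ∈ Metric.ball (0 : ℝ × ℝ) R, f z ∈ O' := fun z hz =>
    (hΦX _ (Hδ _ (hmem z hz).1).2 _ (hmem z hz).2).1
  have hft : ∀ z ∈ Metric.ball (0 : ℝ × ℝ) R, fderiv ℝ f z (0, 1) = X (f z) := by
    rintro ⟨s, t⟩ hz
    have h1 := (hfd _ hz).comp_hasDerivAt t ((hasDerivAt_const t s).prodMk (hasDerivAt_id t))
    exact h1.unique (hΦX _ (Hδ _ (hmem _ hz).1).2 _ (hmem _ hz).2).2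
  have hR1 : ∀ s ∈ Metric.ball (0 : ℝ) R, ∀ t ∈ Metric.ball (0 : ℝ) R,
      (s, t) ∈ Metric.ball (0 : ℝ × ℝ) R := by
    intro s hs t ht
    have : (s, t) ∈ Metric.ball (0 : ℝ) R ×ˢ Metric.ball (0 : ℝ) R := ⟨hs, ht⟩
    rw [ball_prod_same] at this
    exact this
  have hR0 : (0 : ℝ) ∈ Metric.ball (0 : ℝ) R := Metric.mem_ball_self hR
  have hfs : ∀ s ∈ Metric.ball (0 : ℝ) R, fderiv ℝ f (s, 0) (1, 0) = Z (γ s) := by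
    intro s hs
    have h1 := (hfd _ (hR1 s hs 0 hR0)).comp_hasDerivAt s
      ((hasDerivAt_id s).prodMk (hasDerivAt_const s (0 : ℝ)))
    have hsδ : s ∈ Metric.ball (0 : ℝ) δ := (hmem _ (hR1 s hs 0 hR0)).1
    refine h1.unique ((hΨZ x₀ hx₀ρ s (Hδ s hsδ).1).2.congr_of_eventuallyEq ?_)
    filter_upwards [Metric.isOpen_ball.mem_nhds hsδ] with y hy
    exact hΦ0 _ (Hδ y hy).2
  have hfsΘ : ∀ z ∈ Metric.ball (0 : ℝ × ℝ) R, Θ (f z) (fderiv ℝ f z (1, 0)) = 0 := by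
    rintro ⟨s, t⟩ hz
    have hst : s ∈ Metric.ball (0 : ℝ) R ∧ t ∈ Metric.ball (0 : ℝ) R := by
      have hz' : (s, t) ∈ Metric.ball (0 : ℝ) R ×ˢ Metric.ball (0 : ℝ) R := by
        rw [ball_prod_same]
        exact hz
      exact hz'
    let a : ℝ → F := fun t => Θ (f (s, t)) (fderiv ℝ f (s, t) (1, 0))
    have ha : ∀ t ∈ Ioo (-R) R, HasDerivAt a (A (f (s, t)) (a t)) t := by
      intro t ht
      have htR : t ∈ Metric.ball (0 : ℝ) R := by simpa [abs_lt] using ht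
      have hq := hR1 s hst.1 t htR
      have hX' : ∀ᶠ z in 𝓝 (s, t), fderiv ℝ f z (0, 1) = X (f z) := by
        filter_upwards [Metric.isOpen_ball.mem_nhds hq] with z hz using hft z hz
      have hfΩ : f (s, t) ∈ Ω := hOΩ (hfO _ hq).1
      have h1 := fderiv_form_apply_of_cauchy hΩ hX hΘ hXΘ (hfat _ hq) hfΩ hX'
      rw [hAeq _ (hfO _ hq).1] at h1
      have h2 : DifferentiableAt ℝ (fun z => Θ (f z) (fderiv ℝ f z (1, 0))) (s, t) :=
        (((hΘ.contDiffAt (hΩ.mem_nhds hfΩ)).comp _ (hfat _ hq)).differentiableAt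
          (by simp)).clm_apply ((((hfat _ hq).fderiv_right (m := ∞) (by simp)).differentiableAt
          (by simp)).clm_apply (differentiableAt_const _))
      have h3 := h2.hasFDerivAt.comp_hasDerivAt t
        ((hasDerivAt_const t s).prodMk (hasDerivAt_id t))
      rw [h1] at h3
      exact h3
    have ha0 : a 0 = 0 := by
      have hs0 := hR1 s hst.1 0 hR0
      have hf0 : f (s, 0) = γ s := hΦ0 _ (Hδ s (hmem _ hs0).1).2
      have hγO : γ s ∈ O := (hΨZ x₀ hx₀ρ s (Hδ s (hmem _ hs0).1).1).1
      change Θ (f (s, 0)) (fderiv ℝ f (s, 0) (1, 0)) = 0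
      rw [hfs s hst.1, hf0, map_sub, hΘW' _ hγO, sub_self]
    have heq := ODE_solution_unique_of_mem_Ioo (v := fun t y => A (f (s, t)) y)
      (s := fun _ => univ) (K := K) (f := a) (g := fun _ => 0) (t₀ := 0) (a := -R) (b := R)
      (fun t ht => by
        have hq := hR1 s hst.1 t (by simpa [abs_lt] using ht)
        exact ((A (f (s, t))).lipschitz.weaken (hfO _ hq).2.le).lipschitzOnWith)
      (by simpa using hR) (fun t ht => ⟨ha t ht, mem_univ _⟩)
      (fun t _ => ⟨by simpa using hasDerivAt_const t (0 : F), mem_univ _⟩) ha0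
    exact heq (by simpa [abs_lt] using hst.2)
  refine ⟨f, R, hR, hf, (hΦ0 _ (Hδ 0 (Metric.mem_ball_self hδ)).2).trans hγ0, ?_, fun z hz =>
    ⟨hOΩ (hfO z hz).1, hft z hz, ?_⟩⟩
  · have := hfs 0 hR0
    rw [Prod.zero_eq_mk, this, hγ0]
    simp [Z, hw]
  · ext
    · simpa using hfsΘ z hz
    · simp [hft z hz, hXΘ _ (hOΩ (hfO z hz).1)]

end SweptSurface

section ManifoldMaps

variable {E : Type*} [NormedAddCommGroup E] [NormedSpace ℝ E]
  {H : Type*} [TopologicalSpace H] (I : ModelWithCorners ℝ E H)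
  {M : Type*} [TopologicalSpace M] [ChartedSpace H M]
  {E' : Type*} [NormedAddCommGroup E'] [NormedSpace ℝ E']
  {H' : Type*} [TopologicalSpace H'] (I' : ModelWithCorners ℝ E' H')
  {M' : Type*} [TopologicalSpace M'] [ChartedSpace H' M']

/-- The tangent map at a point, as a linear map between the model spaces. -/
def tmap (g : M → M') (q : M) : E →L[ℝ] E' := mfderiv I I' g q

end ManifoldMaps

section ManifoldForms

variable {E : Type*} [NormedAddCommGroup E] [NormedSpace ℝ E]
  {H : Type*} [TopologicalSpace H] (I : ModelWithCorners ℝ E H)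
  {M : Type*} [TopologicalSpace M] [ChartedSpace H M] [IsManifold I ∞ M]

/-- The `1`-form `θ` is smooth at the point `q`. -/
def SmoothFormAt (θ : OneForm I M) (q : M) : Prop :=
  ContMDiffAt I (I.prod 𝓘(ℝ, E →L[ℝ] ℝ)) ∞
    (fun p => Bundle.TotalSpace.mk' (E →L[ℝ] ℝ)
      (E := fun p : M => TangentSpace I p →L[ℝ] Bundle.Trivial M ℝ p) p (θ p)) q

/-- The value of a `1`-form at a point, as a functional on the model space. -/
def cov (θ : OneForm I M) (q : M) : E →L[ℝ] ℝ := θ q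

/-- The exterior derivative of a `1`-form at a point, as a bilinear form on the model space. -/
def dForm (θ : OneForm I M) (q : M) : E →L[ℝ] E →L[ℝ] ℝ := extDerivForm I θ q

variable {I}

lemma smoothFormOn_iff {θ : OneForm I M} {U : Set M} (hU : IsOpen U) :
    SmoothFormOn I θ U ↔ ∀ q ∈ U, SmoothFormAt I θ q :=
  ⟨fun h q hq => (h q hq).contMDiffAt (hU.mem_nhds hq), fun h q hq => (h q hq).contMDiffWithinAt⟩

variable [I.Boundaryless]

lemma contMDiffAt_comp_extChartAt_iff {F : Type*} [NormedAddCommGroup F] [NormedSpace ℝ F]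
    {f : E → F} {p q : M} (hq : q ∈ (extChartAt I p).source) :
    ContMDiffAt I 𝓘(ℝ, F) ∞ (fun y => f (extChartAt I p y)) q ↔
      ContDiffAt ℝ ∞ f (extChartAt I p q) := by
  have hqt := (extChartAt I p).map_source hq
  constructor
  · intro h
    have h1 : ContMDiffAt 𝓘(ℝ, E) I ∞ (extChartAt I p).symm (extChartAt I p q) :=
      (contMDiffOn_extChartAt_symm p).contMDiffAt ((isOpen_extChartAt_target p).mem_nhds hqt)
    have h2 := ContMDiffAt.comp (g := fun y => f (extChartAt I p y)) (extChartAt I p q)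
      (by rw [(extChartAt I p).left_inv hq]; exact h) h1
    refine h2.contDiffAt.congr_of_eventuallyEq ?_
    filter_upwards [(isOpen_extChartAt_target p).mem_nhds hqt] with x hx
    exact congrArg f ((extChartAt I p).right_inv hx).symm
  · intro h
    exact h.contMDiffAt.comp q (contMDiffAt_extChartAt' (by simpa using hq))

lemma chartForm_extChartAt (θ : OneForm I M) {p y : M} (hy : y ∈ (extChartAt I p).source) :
    chartForm I θ p (extChartAt I p y) =
      (cov I θ y).comp (tmap 𝓘(ℝ, E) I (extChartAt I p).symm (extChartAt I p y)) :=
  congrArg (fun z => (cov I θ z).comp (tmap 𝓘(ℝ, E) I (extChartAt I p).symm (extChartAt I p y)))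
    ((extChartAt I p).left_inv hy)

/-- A form is smooth at `q` if and only if its expression in a chart around `q` is. -/
lemma smoothFormAt_iff {θ : OneForm I M} {p q : M} (hq : q ∈ (extChartAt I p).source) :
    SmoothFormAt I θ q ↔ ContDiffAt ℝ ∞ (chartForm I θ p) (extChartAt I p q) := by
  have hq' : q ∈ (chartAt H p).source := by simpa using hq
  let e₁ := trivializationAt E (TangentSpace I : M → Type _) p
  let e₂ := trivializationAt ℝ (Bundle.Trivial M ℝ) p
  let e := e₁.continuousLinearMap (RingHom.id ℝ) e₂
  have he : q ∈ e.baseSet := ⟨by simpa [e₁] using hq', by simp [e₂]⟩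
  rw [SmoothFormAt, e.contMDiffAt_section_iff he, ← contMDiffAt_comp_extChartAt_iff hq]
  refine Filter.EventuallyEq.contMDiffAt_iff ?_
  filter_upwards [(chartAt H p).open_source.mem_nhds hq'] with y hy
  have hy' : y ∈ (extChartAt I p).source := by simpa using hy
  have hsymm := TangentBundle.symmL_trivializationAt (I := I) hy
  rw [I.range_eq_univ, mfderivWithin_univ] at hsymm
  have h1 : e₂.continuousLinearMapAt ℝ y = ContinuousLinearMap.id ℝ ℝ := by
    ext
    simp [e₂]
  have h2 : (e ⟨y, θ y⟩).2 = (e₂.continuousLinearMapAt ℝ y).comp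
      ((cov I θ y).comp (show E →L[ℝ] E from e₁.symmL ℝ y)) := rfl
  have h3 : (show E →L[ℝ] E from e₁.symmL ℝ y) =
      tmap 𝓘(ℝ, E) I (extChartAt I p).symm (extChartAt I p y) := hsymm
  rw [h2, h3, chartForm_extChartAt θ hy']
  exact congrArg (fun l : ℝ →L[ℝ] ℝ => l.comp _) h1

lemma tmap_extChartAt_symm_comp {p y : M} (hy : y ∈ (extChartAt I p).source) (v : E) :
    tmap 𝓘(ℝ, E) I (extChartAt I p).symm (extChartAt I p y)
      (tmap I 𝓘(ℝ, E) (extChartAt I p) y v) = v := by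
  have h := mfderivWithin_extChartAt_symm_comp_mfderiv_extChartAt' (I := I) hy
  rw [I.range_eq_univ, mfderivWithin_univ] at h
  exact congrArg (fun l : E →L[ℝ] E => l v) h

lemma tmap_extChartAt_comp_symm {p y : M} (hy : y ∈ (extChartAt I p).source) (v : E) :
    tmap I 𝓘(ℝ, E) (extChartAt I p) y
      (tmap 𝓘(ℝ, E) I (extChartAt I p).symm (extChartAt I p y) v) = v := by
  have h := mfderiv_extChartAt_comp_mfderivWithin_extChartAt_symm' (I := I) hy
  rw [I.range_eq_univ, mfderivWithin_univ] at h
  exact congrArg (fun l : E →L[ℝ] E => l v) h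

lemma chartForm_tmap (θ : OneForm I M) {p y : M} (hy : y ∈ (extChartAt I p).source) (v : E) :
    chartForm I θ p (extChartAt I p y) (tmap I 𝓘(ℝ, E) (extChartAt I p) y v) = cov I θ y v := by
  rw [chartForm_extChartAt θ hy, ContinuousLinearMap.comp_apply, tmap_extChartAt_symm_comp hy]

lemma tmap_extChartAt_self (p : M) :
    tmap I 𝓘(ℝ, E) (extChartAt I p) p = ContinuousLinearMap.id ℝ E := mfderiv_extChartAt_self

lemma dForm_eq (θ : OneForm I M) (p : M) :
    dForm I θ p = extD (chartForm I θ p) (extChartAt I p p) := by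
  ext v w
  have h : dForm I θ p v w = extD (chartForm I θ p) (extChartAt I p p)
    (tmap I 𝓘(ℝ, E) (extChartAt I p) p v) (tmap I 𝓘(ℝ, E) (extChartAt I p) p w) := rfl
  rw [h, tmap_extChartAt_self]
  rfl

lemma chartForm_self (θ : OneForm I M) (p : M) :
    chartForm I θ p (extChartAt I p p) = cov I θ p := by
  ext v
  have := chartForm_tmap θ (mem_extChartAt_source (I := I) p) v
  rwa [tmap_extChartAt_self] at this

variable {E' : Type*} [NormedAddCommGroup E'] [NormedSpace ℝ E']
  {H' : Type*} [TopologicalSpace H'] {I' : ModelWithCorners ℝ E' H'} [I'.Boundaryless]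
  {M' : Type*} [TopologicalSpace M'] [ChartedSpace H' M'] [IsManifold I' ∞ M']

variable (I') in
/-- The pullback of a `1`-form under a map. -/
def pullbackForm (g : M' → M) (θ : OneForm I M) : OneForm I' M' :=
  fun q => (cov I θ (g q)).comp (tmap I' I g q)

lemma tmap_eq_fderiv {g : M' → M} {q : M'} (hg : MDifferentiableAt I' I g q) :
    tmap I' I g q = fderiv ℝ (writtenInExtChartAt I' I q g) (extChartAt I' q q) := by
  have := hg.mfderiv
  rwa [I'.range_eq_univ, fderivWithin_univ] at this

lemma chartForm_pullbackForm {g : M' → M} {q : M'} (hg : ContMDiffAt I' I ∞ g q)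
    (θ : OneForm I M) :
    chartForm I' (pullbackForm I' g θ) q =ᶠ[𝓝 (extChartAt I' q q)] fun x =>
      (chartForm I θ (g q) (writtenInExtChartAt I' I q g x)).comp
        (fderiv ℝ (writtenInExtChartAt I' I q g) x) := by
  have hg1 : ∀ᶠ y in 𝓝 q, ContMDiffAt I' I 1 g y :=
    (contMDiffAt_iff_contMDiffAt_nhds (by simp)).1 (hg.of_le ENat.LEInfty.out)
  have hgs : ∀ᶠ y in 𝓝 q, g y ∈ (extChartAt I (g q)).source :=
    hg.continuousAt.eventually_mem (extChartAt_source_mem_nhds (g q))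
  have hsymm : Tendsto (extChartAt I' q).symm (𝓝 (extChartAt I' q q)) (𝓝 q) := by
    have := continuousAt_extChartAt_symm (I := I') q
    rwa [ContinuousAt, (extChartAt I' q).left_inv (mem_extChartAt_source q)] at this
  filter_upwards [hsymm.eventually hg1, hsymm.eventually hgs,
    (isOpen_extChartAt_target q).mem_nhds (mem_extChartAt_target (I := I') q)] with x hx1 hx2 hxt
  have d1 : MDifferentiableAt 𝓘(ℝ, E') I' (extChartAt I' q).symm x := by
    have := mdifferentiableWithinAt_extChartAt_symm (I := I') hxt
    rwa [I'.range_eq_univ, mdifferentiableWithinAt_univ] at this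
  have d2 : MDifferentiableAt I' I g ((extChartAt I' q).symm x) :=
    hx1.mdifferentiableAt (by simp)
  have d3 : MDifferentiableAt I 𝓘(ℝ, E) (extChartAt I (g q)) (g ((extChartAt I' q).symm x)) :=
    mdifferentiableAt_extChartAt (by simpa using hx2)
  have e1 : fderiv ℝ (writtenInExtChartAt I' I q g) x =
      (tmap I 𝓘(ℝ, E) (extChartAt I (g q)) (g ((extChartAt I' q).symm x))).comp
        ((tmap I' I g ((extChartAt I' q).symm x)).comp
          (tmap 𝓘(ℝ, E') I' (extChartAt I' q).symm x)) := by
    rw [← mfderiv_eq_fderiv]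
    have h1 := mfderiv_comp x (d3.comp _ d2) d1
    have h2 := mfderiv_comp ((extChartAt I' q).symm x) d3 d2
    rw [h2] at h1
    exact h1
  rw [e1]
  ext v
  have e2 := chartForm_tmap θ hx2
    (tmap I' I g ((extChartAt I' q).symm x) (tmap 𝓘(ℝ, E') I' (extChartAt I' q).symm x v))
  exact e2.symm

lemma dForm_pullbackForm {g : M' → M} {q : M'} (hg : ContMDiffAt I' I ∞ g q)
    {θ : OneForm I M} (hθ : SmoothFormAt I θ (g q)) (v w : E') :
    dForm I' (pullbackForm I' g θ) q v w =
      dForm I θ (g q) (tmap I' I g q v) (tmap I' I g q w) := by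
  have hφ : ContDiffAt ℝ ∞ (writtenInExtChartAt I' I q g) (extChartAt I' q q) := by
    have := (contMDiffAt_iff.1 hg).2
    rwa [I'.range_eq_univ, contDiffWithinAt_univ] at this
  have hval : writtenInExtChartAt I' I q g (extChartAt I' q q) = extChartAt I (g q) (g q) := by
    simp [writtenInExtChartAt]
  have hθ' : DifferentiableAt ℝ (chartForm I θ (g q))
      (writtenInExtChartAt I' I q g (extChartAt I' q q)) := by
    rw [hval]
    exact ((smoothFormAt_iff (mem_extChartAt_source _)).1 hθ).differentiableAt (by simp)
  rw [dForm_eq, extD_congr (chartForm_pullbackForm hg θ),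
    extD_pullback (hφ.of_le ENat.LEInfty.out) hθ', dForm_eq,
    tmap_eq_fderiv (hg.mdifferentiableAt (by simp)), hval]

lemma smoothFormAt_pullbackForm {g : M' → M} {q : M'} (hg : ContMDiffAt I' I ∞ g q)
    {θ : OneForm I M} (hθ : SmoothFormAt I θ (g q)) : SmoothFormAt I' (pullbackForm I' g θ) q := by
  have hφ : ContDiffAt ℝ ∞ (writtenInExtChartAt I' I q g) (extChartAt I' q q) := by
    have := (contMDiffAt_iff.1 hg).2
    rwa [I'.range_eq_univ, contDiffWithinAt_univ] at this
  have hval : writtenInExtChartAt I' I q g (extChartAt I' q q) = extChartAt I (g q) (g q) := by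
    simp [writtenInExtChartAt]
  rw [smoothFormAt_iff (mem_extChartAt_source _)]
  refine ContDiffAt.congr_of_eventuallyEq ?_ (chartForm_pullbackForm hg θ)
  refine ContDiffAt.clm_comp (ContDiffAt.comp (g := chartForm I θ (g q)) _ ?_ hφ) (hφ.fderiv_right (by simp))
  rw [hval]
  exact (smoothFormAt_iff (mem_extChartAt_source _)).1 hθ

lemma chartForm_model (η : OneForm 𝓘(ℝ, E) E) (x : E) : chartForm 𝓘(ℝ, E) η x = cov 𝓘(ℝ, E) η := by
  funext y
  have h : tmap 𝓘(ℝ, E) 𝓘(ℝ, E) (extChartAt 𝓘(ℝ, E) x).symm y = ContinuousLinearMap.id ℝ E := by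
    have : ⇑(extChartAt 𝓘(ℝ, E) x).symm = id := by
      simp only [chartAt_self_eq, mfld_simps]
    rw [this]
    exact mfderiv_id
  change (cov 𝓘(ℝ, E) η ((extChartAt 𝓘(ℝ, E) x).symm y)).comp
    (tmap 𝓘(ℝ, E) 𝓘(ℝ, E) (extChartAt 𝓘(ℝ, E) x).symm y) = _
  have h' : (extChartAt 𝓘(ℝ, E) x).symm y = y := by
    simp only [chartAt_self_eq, mfld_simps]
  rw [h, h', ContinuousLinearMap.comp_id]

/-- The exterior derivative may be computed in any chart. -/
lemma extD_chartForm {θ : OneForm I M} {p q : M} (hq : q ∈ (extChartAt I p).source)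
    (hθ : SmoothFormAt I θ q) (v w : E) :
    extD (chartForm I θ p) (extChartAt I p q) v w =
      dForm I θ q (tmap 𝓘(ℝ, E) I (extChartAt I p).symm (extChartAt I p q) v)
        (tmap 𝓘(ℝ, E) I (extChartAt I p).symm (extChartAt I p q) w) := by
  have hqt := (extChartAt I p).map_source hq
  have h1 : ContMDiffAt 𝓘(ℝ, E) I ∞ (extChartAt I p).symm (extChartAt I p q) :=
    (contMDiffOn_extChartAt_symm p).contMDiffAt ((isOpen_extChartAt_target p).mem_nhds hqt)
  have hinv := (extChartAt I p).left_inv hq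
  have h2 := dForm_pullbackForm h1 (θ := θ) (by rwa [hinv]) v w
  rw [hinv] at h2
  rw [← h2, dForm_eq]
  refine congrArg (fun l : E →L[ℝ] E →L[ℝ] ℝ => l v w) ?_
  rw [chartForm_model]
  rfl

lemma dForm_eq_extD {θ : OneForm I M} {p q : M} (hq : q ∈ (extChartAt I p).source)
    (hθ : SmoothFormAt I θ q) (v w : E) :
    dForm I θ q v w = extD (chartForm I θ p) (extChartAt I p q)
      (tmap I 𝓘(ℝ, E) (extChartAt I p) q v) (tmap I 𝓘(ℝ, E) (extChartAt I p) q w) := by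
  rw [extD_chartForm hq hθ, tmap_extChartAt_symm_comp hq, tmap_extChartAt_symm_comp hq]

lemma contDiffAt_comp_extChartAt_symm {F : Type*} [NormedAddCommGroup F] [NormedSpace ℝ F]
    {f : M → F} {p q : M} (hq : q ∈ (extChartAt I p).source) (hf : ContMDiffAt I 𝓘(ℝ, F) ∞ f q) :
    ContDiffAt ℝ ∞ (fun x => f ((extChartAt I p).symm x)) (extChartAt I p q) := by
  rw [← contMDiffAt_comp_extChartAt_iff hq]
  refine hf.congr_of_eventuallyEq ?_
  filter_upwards [extChartAt_source_mem_nhds' hq] with y hy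
  rw [(extChartAt I p).left_inv hy]

lemma SmoothFormAt.smul {f : M → ℝ} {θ : OneForm I M} {q : M}
    (hf : ContMDiffAt I 𝓘(ℝ, ℝ) ∞ f q) (hθ : SmoothFormAt I θ q) :
    SmoothFormAt I (fun p => f p • θ p) q := by
  rw [smoothFormAt_iff (mem_extChartAt_source q)] at hθ ⊢
  exact (contDiffAt_comp_extChartAt_symm (mem_extChartAt_source q) hf).smul hθ

lemma SmoothFormAt.add {θ θ' : OneForm I M} {q : M} (hθ : SmoothFormAt I θ q)
    (hθ' : SmoothFormAt I θ' q) : SmoothFormAt I (fun p => θ p + θ' p) q := by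
  rw [smoothFormAt_iff (mem_extChartAt_source q)] at hθ hθ' ⊢
  exact hθ.add hθ'

lemma chartForm_sum {ι : Type*} (s : Finset ι) (θ : ι → OneForm I M) (p : M) :
    chartForm I (fun q => ∑ i ∈ s, θ i q) p = fun x => ∑ i ∈ s, chartForm I (θ i) p x := by
  funext x
  ext v
  have h : ∀ q : M, ∀ w : E, cov I (fun q => ∑ i ∈ s, θ i q) q w = ∑ i ∈ s, cov I (θ i) q w := by
    intro q w
    exact (sum_apply s (fun i => cov I (θ i) q) w)
  rw [sum_apply]
  exact h _ _

lemma SmoothFormAt.sum {ι : Type*} {s : Finset ι} {θ : ι → OneForm I M} {q : M}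
    (hθ : ∀ i ∈ s, SmoothFormAt I (θ i) q) : SmoothFormAt I (fun p => ∑ i ∈ s, θ i p) q := by
  rw [smoothFormAt_iff (mem_extChartAt_source q), chartForm_sum]
  exact ContDiffAt.sum fun i hi => (smoothFormAt_iff (mem_extChartAt_source q)).1 (hθ i hi)

lemma SmoothFormAt.differentiableAt {θ : OneForm I M} {q : M} (hθ : SmoothFormAt I θ q) :
    DifferentiableAt ℝ (chartForm I θ q) (extChartAt I q q) :=
  ((smoothFormAt_iff (mem_extChartAt_source q)).1 hθ).differentiableAt (by simp)

lemma dForm_add {θ θ' : OneForm I M} {q : M} (hθ : SmoothFormAt I θ q)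
    (hθ' : SmoothFormAt I θ' q) :
    dForm I (fun p => θ p + θ' p) q = dForm I θ q + dForm I θ' q := by
  rw [dForm_eq, dForm_eq, dForm_eq, ← extD_add hθ.differentiableAt hθ'.differentiableAt]
  rfl

lemma dForm_sum {ι : Type*} {s : Finset ι} {θ : ι → OneForm I M} {q : M}
    (hθ : ∀ i ∈ s, SmoothFormAt I (θ i) q) (v w : E) :
    dForm I (fun p => ∑ i ∈ s, θ i p) q v w = ∑ i ∈ s, dForm I (θ i) q v w := by
  simp only [dForm_eq]
  rw [chartForm_sum, extD_sum fun i hi => (hθ i hi).differentiableAt]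

/-- The Leibniz rule for the exterior derivative. -/
lemma dForm_smul {f : M → ℝ} {θ : OneForm I M} {q : M} (hf : ContMDiffAt I 𝓘(ℝ, ℝ) ∞ f q)
    (hθ : SmoothFormAt I θ q) (v w : E) :
    dForm I (fun p => f p • θ p) q v w = f q * dForm I θ q v w +
      (tmap I 𝓘(ℝ, ℝ) f q v * cov I θ q w - tmap I 𝓘(ℝ, ℝ) f q w * cov I θ q v) := by
  have hf' := (contDiffAt_comp_extChartAt_symm (mem_extChartAt_source (I := I) q) hf)
  have h1 := extD_smul (hf'.differentiableAt (by simp)) hθ.differentiableAt v w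
  have h2 : tmap I 𝓘(ℝ, ℝ) f q =
      fderiv ℝ (fun x => f ((extChartAt I q).symm x)) (extChartAt I q q) :=
    tmap_eq_fderiv (hf.mdifferentiableAt (by simp))
  rw [dForm_eq, dForm_eq, h2, ← chartForm_self θ q]
  rw [(extChartAt I q).left_inv (mem_extChartAt_source q)] at h1
  exact h1

end ManifoldForms

lemma surjective_pi_of_linearIndependent {E : Type*} [NormedAddCommGroup E] [NormedSpace ℝ E]
    {ι : Type*} [Fintype ι] {f : ι → E →L[ℝ] ℝ} (h : LinearIndependent ℝ f) :
    Function.Surjective (ContinuousLinearMap.pi f) := by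
  classical
  by_contra hs
  have hlt : LinearMap.range (ContinuousLinearMap.pi f).toLinearMap < ⊤ :=
    lt_top_iff_ne_top.2 fun ht => hs (LinearMap.range_eq_top.1 ht)
  obtain ⟨g, hg, hle⟩ := Submodule.exists_le_ker_of_lt_top _ hlt
  refine hg (LinearMap.pi_ext' fun i => LinearMap.ext_ring ?_)
  refine Fintype.linearIndependent_iff.1 h (fun i => g (Pi.single i 1)) ?_ i
  ext v
  have h1 : g (ContinuousLinearMap.pi f v) = 0 := hle ⟨v, rfl⟩
  rw [LinearMap.pi_apply_eq_sum_univ] at h1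
  have h2 : ∀ i : ι, (fun j => if i = j then (1 : ℝ) else 0) = Pi.single i 1 := fun i => by
    ext j
    simp [Pi.single_apply, eq_comm]
  simpa [mul_comm, h2] using h1

section Derived

variable {E : Type*} [NormedAddCommGroup E] [NormedSpace ℝ E]
  {H : Type*} [TopologicalSpace H] (I : ModelWithCorners ℝ E H)
  {M : Type*} [TopologicalSpace M] [ChartedSpace H M] [IsManifold I ∞ M]

/-- The value of a field of subspaces at a point, as a subspace of the dual of the model space. -/
def fib (P : CotangentField I M) (q : M) : Submodule ℝ (E →L[ℝ] ℝ) := P q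

/-- `P` is spanned over the open set `V` by `n` smooth pointwise independent `1`-forms. -/
structure HasFrameOn (P : CotangentField I M) (n : ℕ) (θ : Fin n → OneForm I M) (V : Set M) :
    Prop where
  isOpen : IsOpen V
  smooth : ∀ i, ∀ q ∈ V, SmoothFormAt I (θ i) q
  independent : ∀ q ∈ V, LinearIndependent ℝ (fun i => cov I (θ i) q)
  span_eq : ∀ q ∈ V, Submodule.span ℝ (range fun i => cov I (θ i) q) = fib I P q

variable {I}

lemma HasFrameOn.mono {P : CotangentField I M} {n : ℕ} {θ : Fin n → OneForm I M} {V V' : Set M}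
    (h : HasFrameOn I P n θ V) (hV' : IsOpen V') (hV : V' ⊆ V) : HasFrameOn I P n θ V' :=
  ⟨hV', fun i q hq => h.smooth i q (hV hq), fun q hq => h.independent q (hV hq),
    fun q hq => h.span_eq q (hV hq)⟩

lemma isSubbundle_iff {P : CotangentField I M} {n : ℕ} :
    IsSubbundle I P n ↔ ∀ p, ∃ V, p ∈ V ∧ ∃ θ, HasFrameOn I P n θ V := by
  constructor
  · intro h p
    obtain ⟨U, hU, hp, θ, h1, h2⟩ := h p
    exact ⟨U, hp, θ, hU, fun i => (smoothFormOn_iff hU).1 (h1 i), fun q hq => (h2 q hq).1,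
      fun q hq => (h2 q hq).2⟩
  · intro h p
    obtain ⟨V, hp, θ, h⟩ := h p
    exact ⟨V, h.isOpen, hp, θ, fun i => (smoothFormOn_iff h.isOpen).2 (h.smooth i),
      fun q hq => ⟨h.independent q hq, h.span_eq q hq⟩⟩

lemma HasFrameOn.finrank_eq {P : CotangentField I M} {n : ℕ} {θ : Fin n → OneForm I M} {V : Set M}
    (h : HasFrameOn I P n θ V) {q : M} (hq : q ∈ V) : Module.finrank ℝ (P q) = n := by
  change Module.finrank ℝ (fib I P q) = n
  rw [← h.span_eq q hq]
  exact (finrank_span_eq_card (h.independent q hq)).trans (by simp)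

lemma HasFrameOn.cov_mem {P : CotangentField I M} {n : ℕ} {θ : Fin n → OneForm I M} {V : Set M}
    (h : HasFrameOn I P n θ V) {q : M} (hq : q ∈ V) (i : Fin n) : cov I (θ i) q ∈ fib I P q :=
  (h.span_eq q hq).le (Submodule.subset_span ⟨i, rfl⟩)

lemma HasFrameOn.annihilates_iff {P : CotangentField I M} {n : ℕ} {θ : Fin n → OneForm I M}
    {V : Set M} (h : HasFrameOn I P n θ V) {q : M} (hq : q ∈ V) (v : E) :
    (∀ η ∈ fib I P q, η v = 0) ↔ ∀ i, cov I (θ i) q v = 0 := by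
  refine ⟨fun hv i => hv _ (h.cov_mem hq i), fun hv η hη => ?_⟩
  rw [← h.span_eq q hq] at hη
  induction hη using Submodule.span_induction with
  | mem x hx =>
    obtain ⟨i, rfl⟩ := hx
    exact hv i
  | zero => rfl
  | add x y _ _ hx hy => rw [add_apply, hx, hy, add_zero]
  | smul a x _ hx => rw [smul_apply, hx, smul_zero]

lemma isSectionOn_iff {P : CotangentField I M} {θ : OneForm I M} {U : Set M} :
    IsSectionOn I P θ U ↔ IsOpen U ∧ (∀ q ∈ U, SmoothFormAt I θ q) ∧ ∀ q ∈ U, cov I θ q ∈ fib I P q :=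
  ⟨fun h => ⟨h.isOpen, (smoothFormOn_iff h.isOpen).1 h.smooth, h.mem⟩,
    fun h => ⟨h.1, (smoothFormOn_iff h.1).2 h.2.1, h.2.2⟩⟩

lemma fib_derivedSystem (P : CotangentField I M) (q : M) : fib I (derivedSystem I P) q =
    Submodule.span ℝ {α : E →L[ℝ] ℝ | ∃ (θ : OneForm I M) (U : Set M), q ∈ U ∧ IsSectionOn I P θ U ∧
      cov I θ q = α ∧ ∀ v w : E, (∀ η ∈ fib I P q, η v = 0) → (∀ η ∈ fib I P q, η w = 0) →
        dForm I θ q v w = 0} := rfl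

lemma derivedSystem_congr {P P' : CotangentField I M} {V : Set M} (hV : IsOpen V)
    (h : ∀ q ∈ V, P q = P' q) : ∀ q ∈ V, derivedSystem I P q = derivedSystem I P' q := by
  have key : ∀ {P P' : CotangentField I M}, (∀ q ∈ V, P q = P' q) → ∀ q ∈ V,
      derivedSystem I P q ≤ derivedSystem I P' q := by
    intro P P' h q hq
    refine Submodule.span_mono ?_
    rintro α ⟨θ, U, hqU, hθ, rfl, hd⟩
    obtain ⟨h1, h2, h3⟩ := isSectionOn_iff.1 hθ
    refine ⟨θ, U ∩ V, ⟨hqU, hq⟩, isSectionOn_iff.2 ⟨h1.inter hV, fun y hy => h2 y hy.1,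
      fun y hy => (h y hy.2).le (h3 y hy.1)⟩, rfl, ?_⟩
    rw [← h q hq]
    exact hd
  exact fun q hq => le_antisymm (key h q hq) (key (fun y hy => (h y hy).symm) q hq)

lemma derivedSystem_le (P : CotangentField I M) (q : M) : derivedSystem I P q ≤ P q := by
  refine Submodule.span_le.2 ?_
  rintro α ⟨θ, U, hqU, hθ, rfl, -⟩
  exact hθ.mem q hqU

variable [I.Boundaryless]

lemma contDiffOn_chartForm {θ : OneForm I M} {V : Set M} (h : ∀ q ∈ V, SmoothFormAt I θ q)
    (p : M) : ContDiffOn ℝ ∞ (chartForm I θ p)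
      ((extChartAt I p).target ∩ (extChartAt I p).symm ⁻¹' V) := by
  intro x hx
  have hs := (extChartAt I p).map_target hx.1
  have := (smoothFormAt_iff hs).1 (h _ hx.2)
  rw [(extChartAt I p).right_inv hx.1] at this
  exact this.contDiffWithinAt

lemma isOpen_chart_inter {V : Set M} (hV : IsOpen V) (p : M) :
    IsOpen ((extChartAt I p).target ∩ (extChartAt I p).symm ⁻¹' V) :=
  (continuousOn_extChartAt_symm p).isOpen_inter_preimage (isOpen_extChartAt_target p) hV

variable [FiniteDimensional ℝ E]

variable (I) in
/-- The expressions in a chart of a family of `1`-forms, as a vector valued form. -/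
def chartFrame {n : ℕ} (θ : Fin n → OneForm I M) (p : M) (x : E) : E →L[ℝ] (Fin n → ℝ) :=
  ContinuousLinearMap.pi fun i => chartForm I (θ i) p x

lemma chartFrame_apply {n : ℕ} (θ : Fin n → OneForm I M) (p : M) (x v : E) (i : Fin n) :
    chartFrame I θ p x v i = chartForm I (θ i) p x v := rfl

lemma contDiffOn_chartFrame {n : ℕ} {θ : Fin n → OneForm I M} {V : Set M}
    (h : ∀ i, ∀ q ∈ V, SmoothFormAt I (θ i) q) (p : M) : ContDiffOn ℝ ∞ (chartFrame I θ p)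
      ((extChartAt I p).target ∩ (extChartAt I p).symm ⁻¹' V) :=
  contDiffOn_clm_apply.2 fun _ => contDiffOn_pi.2 fun i =>
    (contDiffOn_chartForm (h i) p).clm_apply contDiffOn_const

lemma chartFrame_surjective {n : ℕ} {θ : Fin n → OneForm I M} {p q : M}
    (hq : q ∈ (extChartAt I p).source) (h : LinearIndependent ℝ fun i => cov I (θ i) q) :
    Function.Surjective (chartFrame I θ p (extChartAt I p q)) := by
  intro y
  obtain ⟨v, hv⟩ := surjective_pi_of_linearIndependent h y
  refine ⟨tmap I 𝓘(ℝ, E) (extChartAt I p) q v, funext fun i => ?_⟩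
  rw [chartFrame_apply, chartForm_tmap _ hq, ← hv]
  rfl

/-- Sections of a framed Pfaffian system have smooth coefficients, in a chart. -/
lemma HasFrameOn.exists_coeff {P : CotangentField I M} {n : ℕ} {θ : Fin n → OneForm I M}
    {V : Set M} (h : HasFrameOn I P n θ V) {q : M} (hq : q ∈ V) {σ : OneForm I M}
    {U : Set M} (hqU : q ∈ U) (hσ : IsSectionOn I P σ U) :
    ∃ f : Fin n → E → ℝ, (∀ i, DifferentiableAt ℝ (f i) (extChartAt I q q)) ∧
      chartForm I σ q =ᶠ[𝓝 (extChartAt I q q)] fun x => ∑ i, f i x • chartForm I (θ i) q x := by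
  obtain ⟨hU, hσs, hσm⟩ := isSectionOn_iff.1 hσ
  have hqs := mem_extChartAt_source (I := I) q
  have hinv := (extChartAt I q).left_inv hqs
  have hx₀ : extChartAt I q q ∈ (extChartAt I q).target ∩ (extChartAt I q).symm ⁻¹' (V ∩ U) :=
    ⟨(extChartAt I q).map_source hqs, by simpa [hinv] using ⟨hq, hqU⟩⟩
  have hΩ := isOpen_chart_inter (I := I) (h.isOpen.inter hU) q
  obtain ⟨O, hOΩ, hO, hxO, W, hW, hΘW⟩ := exists_smooth_rightInverse hΩ
    (contDiffOn_chartFrame (fun i y hy => h.smooth i y hy.1) q) hx₀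
    (chartFrame_surjective hqs (h.independent q hq))
  have hσc := (contDiffOn_chartForm (fun y (hy : y ∈ V ∩ U) => hσs y hy.2) q).mono hOΩ
  refine ⟨fun i x => chartForm I σ q x (W x (Pi.single i 1)), fun i => ?_, ?_⟩
  · exact ((hσc.clm_apply (hW.clm_apply contDiffOn_const)).contDiffAt
      (hO.mem_nhds hxO)).differentiableAt (by simp)
  · filter_upwards [hO.mem_nhds hxO] with x hx
    obtain ⟨hxt, hxV, hxU⟩ := hOΩ hx
    have hm := hσm _ hxU
    rw [← h.span_eq _ hxV, Submodule.mem_span_range_iff_exists_fun] at hm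
    obtain ⟨c, hc⟩ := hm
    have h1 : chartForm I σ q x = ∑ i, c i • chartForm I (θ i) q x := by
      ext v
      have := congrArg (fun l : E →L[ℝ] ℝ =>
        l (tmap 𝓘(ℝ, E) I (extChartAt I q).symm x v)) hc.symm
      simp only [sum_apply, smul_apply] at this ⊢
      exact this
    have h2 : ∀ i j, chartForm I (θ i) q x (W x (Pi.single j 1)) =
        (Pi.single j 1 : Fin n → ℝ) i := by
      intro i j
      have := congrArg (fun l : (Fin n → ℝ) →L[ℝ] (Fin n → ℝ) => l (Pi.single j 1) i) (hΘW x hx)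
      exact this
    have h3 : ∀ j, chartForm I σ q x (W x (Pi.single j 1)) = c j := by
      intro j
      rw [h1]
      simp [h2, Pi.single_apply]
    simp only [h3]
    exact h1

lemma HasFrameOn.fib_derivedSystem {P : CotangentField I M} {n : ℕ} {θ : Fin n → OneForm I M}
    {V : Set M} (h : HasFrameOn I P n θ V) {q : M} (hq : q ∈ V) {K : Submodule ℝ (Fin n → ℝ)}
    (hK : ∀ c, c ∈ K ↔ ∀ v w : E, (∀ i, cov I (θ i) q v = 0) → (∀ i, cov I (θ i) q w = 0) →
        ∑ i, c i * dForm I (θ i) q v w = 0) :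
    fib I (derivedSystem I P) q =
      K.map (Fintype.linearCombination ℝ fun i => cov I (θ i) q) := by
  have hθd : ∀ i, DifferentiableAt ℝ (chartForm I (θ i) q) (extChartAt I q q) := fun i =>
    (h.smooth i q hq).differentiableAt
  rw [PfaffianSystem.fib_derivedSystem]
  refine le_antisymm (Submodule.span_le.2 ?_) ?_
  · rintro α ⟨σ, U, hqU, hσ, rfl, hd⟩
    obtain ⟨f, hf, heq⟩ := h.exists_coeff hq hqU hσ
    refine ⟨fun i => f i (extChartAt I q q), (hK _).2 fun v w hv hw => ?_, ?_⟩
    · have h1 := hd v w ((h.annihilates_iff hq v).2 hv) ((h.annihilates_iff hq w).2 hw)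
      rw [dForm_eq, extD_congr heq,
        extD_sum (η := fun i x => f i x • chartForm I (θ i) q x) fun i _ => (hf i).smul (hθd i)]
        at h1
      rw [← h1]
      refine Finset.sum_congr rfl fun i _ => ?_
      rw [extD_smul (hf i) (hθd i), chartForm_self, hv i, hw i, dForm_eq]
      simp
    · have := heq.self_of_nhds
      simp only [chartForm_self] at this
      rw [this, Fintype.linearCombination_apply]
  · rintro _ ⟨c, hc, rfl⟩
    have hc' := (hK c).1 hc
    have hs : ∀ i, ∀ y ∈ V, SmoothFormAt I (fun p => c i • θ i p) y := fun i y hy =>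
      SmoothFormAt.smul contMDiffAt_const (h.smooth i y hy)
    refine Submodule.subset_span ⟨fun p => ∑ i, c i • θ i p, V, hq, isSectionOn_iff.2
      ⟨h.isOpen, fun y hy => SmoothFormAt.sum fun i _ => hs i y hy, fun y hy =>
        (fib I P y).sum_mem fun i _ => (fib I P y).smul_mem _ (h.cov_mem hy i)⟩, ?_, ?_⟩
    · rw [Fintype.linearCombination_apply]
      rfl
    intro v w hv hw
    have hv' := (h.annihilates_iff hq v).1 hv
    have hw' := (h.annihilates_iff hq w).1 hw
    rw [← hc' v w hv' hw']
    refine (dForm_sum (fun i _ => hs i q hq) v w).trans (Finset.sum_congr rfl fun i _ => ?_)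
    rw [dForm_smul (f := fun _ => c i) contMDiffAt_const (h.smooth i q hq), hv' i, hw' i]
    simp

set_option maxSynthPendingDepth 3 in
/-- Over a smaller open set, the derived system of a framed Pfaffian system is again framed. -/
lemma HasFrameOn.exists_frame_derivedSystem {P : CotangentField I M} {n : ℕ}
    {θ : Fin n → OneForm I M} {V : Set M} (h : HasFrameOn I P n θ V) (hV : V.Nonempty) :
    ∃ V' ⊆ V, V'.Nonempty ∧ ∃ (m : ℕ) (θ' : Fin m → OneForm I M),
      HasFrameOn I (derivedSystem I P) m θ' V' := by
  obtain ⟨p, hp⟩ := hV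
  have hps := mem_extChartAt_source (I := I) p
  let Ω := (extChartAt I p).target ∩ (extChartAt I p).symm ⁻¹' V
  have hΩ : IsOpen Ω := isOpen_chart_inter h.isOpen p
  have hpΩ : extChartAt I p p ∈ Ω :=
    ⟨(extChartAt I p).map_source hps, by simpa [(extChartAt I p).left_inv hps] using hp⟩
  have hη : ∀ i, ContDiffOn ℝ ∞ (chartForm I (θ i) p) Ω := fun i =>
    contDiffOn_chartForm (h.smooth i) p
  have hΘ : ContDiffOn ℝ ∞ (chartFrame I θ p) Ω := contDiffOn_chartFrame h.smooth p
  obtain ⟨O, hOΩ, hO, hpO, W, hW, hΘW⟩ := exists_smooth_rightInverse hΩ hΘ hpΩ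
    (chartFrame_surjective hps (h.independent p hp))
  let Pr : E → E →L[ℝ] E := fun x =>
    ContinuousLinearMap.id ℝ E - (W x).comp (chartFrame I θ p x)
  have hPr : ContDiffOn ℝ ∞ Pr O := contDiffOn_const.sub (hW.clm_comp (hΘ.mono hOΩ))
  have hPrΘ : ∀ x ∈ O, ∀ v, chartFrame I θ p x (Pr x v) = 0 := by
    intro x hx v
    have h1 := congrArg (fun l : (Fin n → ℝ) →L[ℝ] (Fin n → ℝ) => l (chartFrame I θ p x v))
      (hΘW x hx)
    simp only [ContinuousLinearMap.comp_apply, ContinuousLinearMap.id_apply] at h1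
    simp [Pr, h1]
  have hPrid : ∀ x v, chartFrame I θ p x v = 0 → Pr x v = v := by
    intro x v hv
    simp [Pr, hv]
  let D : Fin n → E → E →L[ℝ] E →L[ℝ] ℝ := fun i x =>
    (extD (chartForm I (θ i) p) x).bilinearComp (Pr x) (Pr x)
  have hD : ∀ i, ContDiffOn ℝ ∞ (D i) O := fun i =>
    contDiffOn_clm_apply.2 fun v => contDiffOn_clm_apply.2 fun w =>
      (((contDiffOn_extD hΩ (hη i)).mono hOΩ).clm_apply (hPr.clm_apply contDiffOn_const)).clm_apply
        (hPr.clm_apply contDiffOn_const)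
  let B : E → (Fin n → ℝ) →L[ℝ] E →L[ℝ] E →L[ℝ] ℝ := fun x =>
    ∑ i, (ContinuousLinearMap.proj (R := ℝ) (φ := fun _ : Fin n => ℝ) i).smulRight (D i x)
  have hBapp : ∀ x c v w, B x c v w =
      ∑ i, c i * extD (chartForm I (θ i) p) x (Pr x v) (Pr x w) := by
    intro x c v w
    simp [B, D]
  have hB : ContDiffOn ℝ ∞ B O := contDiffOn_clm_apply.2 fun c => by
    have : ContDiffOn ℝ ∞ (fun x => ∑ i, c i • D i x) O :=
      ContDiffOn.sum fun i _ => contDiffOn_const.smul (f := fun _ => c i) (hD i)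
    refine this.congr fun x _ => ?_
    simp [B]
  obtain ⟨O', hO'O, hO', ⟨x₁, hx₁⟩, m, k, hk, hkspan⟩ := exists_kernel_frame hO ⟨_, hpO⟩ hB
  let V' : Set M := (extChartAt I p).source ∩ extChartAt I p ⁻¹' O'
  have hV' : IsOpen V' := (continuousOn_extChartAt p).isOpen_inter_preimage
    (isOpen_extChartAt_source p) hO'
  have hV'V : V' ⊆ V := fun q hq => by
    have := (hOΩ (hO'O hq.2)).2
    rwa [mem_preimage, (extChartAt I p).left_inv hq.1] at this
  refine ⟨V', hV'V, ⟨(extChartAt I p).symm x₁, ?_⟩, m,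
    fun j q => ∑ i, k j (extChartAt I p q) i • θ i q, hV', ?_, ?_, ?_⟩
  · have hx₁t := (hOΩ (hO'O hx₁)).1
    refine ⟨(extChartAt I p).map_target hx₁t, ?_⟩
    rwa [mem_preimage, (extChartAt I p).right_inv hx₁t]
  · intro j q hq
    refine SmoothFormAt.sum fun i _ => SmoothFormAt.smul ?_ (h.smooth i q (hV'V hq))
    exact (contMDiffAt_comp_extChartAt_iff (f := fun x => k j x i) hq.1).2
      (contDiffAt_pi.1 ((hk j).contDiffAt (hO'.mem_nhds hq.2)) i)
  · intro q hq
    have h1 := (hkspan _ hq.2).1.map' (Fintype.linearCombination ℝ fun i => cov I (θ i) q)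
      (LinearMap.ker_eq_bot.2 (linearIndependent_iff_injective_fintypeLinearCombination.1
        (h.independent q (hV'V hq))))
    exact h1
  · intro q hq
    rw [h.fib_derivedSystem (hV'V hq)
      (K := LinearMap.ker (B (extChartAt I p q)).toLinearMap), ← (hkspan _ hq.2).2,
      Submodule.map_span, ← range_comp]
    · rfl
    intro c
    have hsm : ∀ i, SmoothFormAt I (θ i) q := fun i => h.smooth i q (hV'V hq)
    have hxO := hO'O hq.2
    constructor
    · intro hc v w hv hw
      have h1 : B (extChartAt I p q) c = 0 := hc
      have hfix : ∀ u, (∀ i, cov I (θ i) q u = 0) → Pr (extChartAt I p q)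
          (tmap I 𝓘(ℝ, E) (extChartAt I p) q u) = tmap I 𝓘(ℝ, E) (extChartAt I p) q u := by
        intro u hu
        refine hPrid _ _ (funext fun i => ?_)
        rw [chartFrame_apply, chartForm_tmap _ hq.1, hu i]
        rfl
      have h2 := hBapp (extChartAt I p q) c (tmap I 𝓘(ℝ, E) (extChartAt I p) q v)
        (tmap I 𝓘(ℝ, E) (extChartAt I p) q w)
      rw [h1, hfix v hv, hfix w hw] at h2
      refine Eq.trans (Finset.sum_congr rfl fun i _ => ?_) h2.symm
      rw [dForm_eq_extD hq.1 (hsm i)]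
    · intro hc
      have hann : ∀ u i, cov I (θ i) q (tmap 𝓘(ℝ, E) I (extChartAt I p).symm (extChartAt I p q)
          (Pr (extChartAt I p q) u)) = 0 := by
        intro u i
        have h1 := congrFun (hPrΘ _ hxO u) i
        rw [chartFrame_apply, chartForm_extChartAt _ hq.1] at h1
        exact h1
      change B (extChartAt I p q) c = 0
      ext v w
      rw [hBapp]
      refine Eq.trans (Finset.sum_congr rfl fun i _ => ?_) (hc _ _ (hann v) (hann w))
      rw [extD_chartForm hq.1 (hsm i)]

/-- Every nonempty open set over which a Pfaffian system is framed contains a nonempty open set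
on which all the iterated derived systems have constant ranks. -/
lemma HasFrameOn.exists_hasConstantDerivedRanksOn (n : ℕ) : ∀ {P : CotangentField I M}
    {θ : Fin n → OneForm I M} {V : Set M}, HasFrameOn I P n θ V → V.Nonempty →
    ∃ U ⊆ V, IsOpen U ∧ U.Nonempty ∧ HasConstantDerivedRanksOn I P U := by
  induction n using Nat.strong_induction_on with
  | _ n ih =>
    intro P θ V h hV
    obtain ⟨V', hV'V, hV'ne, m, θ', h'⟩ := h.exists_frame_derivedSystem hV
    have hle : ∀ q ∈ V', m ≤ n ∧ (m = n → derivedSystem I P q = P q) := by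
      intro q hq
      have h1 := h'.finrank_eq hq
      have h2 := h.finrank_eq (hV'V hq)
      have hfd : FiniteDimensional ℝ (fib I P q) := by infer_instance
      have h3 : fib I (derivedSystem I P) q ≤ fib I P q := derivedSystem_le P q
      have h4 : Module.finrank ℝ (fib I (derivedSystem I P) q) ≤ Module.finrank ℝ (fib I P q) :=
        Submodule.finrank_mono h3
      have h5 : Module.finrank ℝ (fib I (derivedSystem I P) q) = m := h1
      have h6 : Module.finrank ℝ (fib I P q) = n := h2
      refine ⟨h5 ▸ h6 ▸ h4, fun hmn => ?_⟩
      have h7 : fib I (derivedSystem I P) q = fib I P q :=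
        Submodule.eq_of_le_of_finrank_eq h3 (h5.trans (hmn.trans h6.symm))
      exact h7
    rcases (hle _ hV'ne.some_mem).1.lt_or_eq with hlt | heq
    · obtain ⟨U, hUV, hU, hUne, hr⟩ := ih m hlt h' hV'ne
      refine ⟨U, hUV.trans hV'V, hU, hUne, fun k => ?_⟩
      cases k with
      | zero => exact ⟨n, fun q hq => h.finrank_eq (hV'V (hUV hq))⟩
      | succ k => exact hr k
    · refine ⟨V', hV'V, h'.isOpen, hV'ne, fun k => ⟨n, fun q hq => ?_⟩⟩
      have : ∀ k, ∀ q ∈ V', (derivedSystem I)^[k] P q = P q := by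
        intro k
        induction k with
        | zero => exact fun q _ => rfl
        | succ k ihk =>
          intro q hq
          rw [Function.iterate_succ_apply',
            derivedSystem_congr h'.isOpen ihk q hq, (hle q hq).2 heq]
      rw [this k q hq, h.finrank_eq (hV'V hq)]

end Derived

lemma exists_diffeomorphism_plane_ball {δ : ℝ} (hδ : 0 < δ) :
    ∃ β : EuclideanSpace ℝ (Fin 2) → ℝ × ℝ, ContDiff ℝ ∞ β ∧
      ∀ s, β s ∈ Metric.ball 0 δ ∧ Function.Bijective (fderiv ℝ β s) := by
  let ℓ : EuclideanSpace ℝ (Fin 2) →L[ℝ] ℝ × ℝ :=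
    (EuclideanSpace.proj 0).prod (EuclideanSpace.proj 1)
  have hℓ : Function.Injective ℓ := by
    intro x y hxy
    ext i
    fin_cases i
    · exact congrArg Prod.fst hxy
    · exact congrArg Prod.snd hxy
  obtain ⟨ε, hε, hball⟩ : ∃ ε > 0, ∀ x ∈ Metric.ball (0 : EuclideanSpace ℝ (Fin 2)) ε,
      ℓ x ∈ Metric.ball 0 δ := by
    refine Metric.eventually_nhds_iff_ball.1 (ℓ.continuous.continuousAt.eventually ?_)
    rw [map_zero]
    exact Metric.ball_mem_nhds 0 hδ
  let b := OpenPartialHomeomorph.univBall (0 : EuclideanSpace ℝ (Fin 2)) ε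
  have hb : ContDiff ℝ ∞ b := OpenPartialHomeomorph.contDiff_univBall
  have hbt : ∀ s, b s ∈ Metric.ball 0 ε := fun s => by
    rw [← OpenPartialHomeomorph.univBall_target (0 : EuclideanSpace ℝ (Fin 2)) hε]
    exact b.map_source (by simp [b])
  refine ⟨fun s => ℓ (b s), ℓ.contDiff.comp hb, fun s => ⟨hball _ (hbt s), ?_⟩⟩
  have hinj : Function.Injective (fderiv ℝ (fun s => ℓ (b s)) s) := by
    have h1 : fderiv ℝ (fun s => ℓ (b s)) s = ℓ.comp (fderiv ℝ b s) :=
      (ℓ.hasFDerivAt.comp s (hb.differentiable (by simp) s).hasFDerivAt).fderiv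
    have h2 : DifferentiableAt ℝ b.symm (b s) :=
      (OpenPartialHomeomorph.contDiffOn_univBall_symm.contDiffAt
        (Metric.isOpen_ball.mem_nhds (hbt s))).differentiableAt (n := ∞) (by simp)
    have h3 : (fderiv ℝ b.symm (b s)).comp (fderiv ℝ b s) = ContinuousLinearMap.id ℝ _ := by
      refine (h2.hasFDerivAt.comp s (hb.differentiable (by simp) s).hasFDerivAt).unique ?_
      refine (hasFDerivAt_id s).congr_of_eventuallyEq (Eventually.of_forall fun y => ?_)
      exact b.left_inv (by simp [b])
    rw [h1]
    refine hℓ.comp (Function.LeftInverse.injective (g := fderiv ℝ b.symm (b s)) fun v => ?_)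
    exact congrArg (fun l : EuclideanSpace ℝ (Fin 2) →L[ℝ] EuclideanSpace ℝ (Fin 2) => l v) h3
  refine ⟨hinj, ?_⟩
  exact (LinearMap.injective_iff_surjective_of_finrank_eq_finrank
    (f := (fderiv ℝ (fun s => ℓ (b s)) s).toLinearMap) (by simp)).1 hinj

section IntegralSurface

variable {E : Type*} [NormedAddCommGroup E] [NormedSpace ℝ E] [FiniteDimensional ℝ E]
  {H : Type*} [TopologicalSpace H] {I : ModelWithCorners ℝ E H} [I.Boundaryless]
  {M : Type*} [TopologicalSpace M] [ChartedSpace H M] [IsManifold I ∞ M]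

/-- A vector field at a point, as a vector of the model space. -/
def vec (X : ∀ p : M, TangentSpace I p) (q : M) : E := X q

lemma SmoothFieldOn.contDiffOn_chart {X : ∀ p : M, TangentSpace I p} {V : Set M} (hV : IsOpen V)
    (hX : SmoothFieldOn I X V) (p : M) :
    ContDiffOn ℝ ∞ (fun x => tmap I 𝓘(ℝ, E) (extChartAt I p) ((extChartAt I p).symm x)
      (vec X ((extChartAt I p).symm x))) ((extChartAt I p).target ∩ (extChartAt I p).symm ⁻¹' V) := by
  intro x hx
  have hs := (extChartAt I p).map_target hx.1
  have hs' : (extChartAt I p).symm x ∈ (chartAt H p).source := by simpa using hs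
  let e := trivializationAt E (TangentSpace I : M → Type _) p
  have he : (extChartAt I p).symm x ∈ e.baseSet := by simpa [e] using hs'
  have h1 : ContMDiffAt I I.tangent ∞ (fun p => (⟨p, X p⟩ : TangentBundle I M))
      ((extChartAt I p).symm x) := (hX _ hx.2).contMDiffAt (hV.mem_nhds hx.2)
  have h2 := (e.contMDiffAt_section_iff he).1 h1
  have h3 := contDiffAt_comp_extChartAt_symm hs h2
  rw [(extChartAt I p).right_inv hx.1] at h3
  refine (h3.congr_of_eventuallyEq ?_).contDiffWithinAt
  filter_upwards [(isOpen_extChartAt_target p).mem_nhds hx.1] with y hy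
  have hys : (extChartAt I p).symm y ∈ (chartAt H p).source := by
    simpa using (extChartAt I p).map_target hy
  have h4 := TangentBundle.continuousLinearMapAt_trivializationAt (I := I) hys
  have h5 := congrArg (fun l : E →L[ℝ] E => l (vec X ((extChartAt I p).symm y))) h4
  refine h5.symm.trans ?_
  exact e.continuousLinearMapAt_apply_of_mem (R := ℝ) (by simpa [e] using hys) _

lemma fderiv_chartFrame {n : ℕ} (θ : Fin n → OneForm I M) (p : M) {x : E}
    (h : DifferentiableAt ℝ (chartFrame I θ p) x) (u v : E) (i : Fin n) :
    fderiv ℝ (chartFrame I θ p) x u v i = fderiv ℝ (chartForm I (θ i) p) x u v := by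
  have h1 := (hasFDerivAt_const (ContinuousLinearMap.proj (R := ℝ) (φ := fun _ : Fin n => ℝ) i)
    x).clm_comp h.hasFDerivAt
  have h2 : (fun y => (ContinuousLinearMap.proj (R := ℝ) (φ := fun _ : Fin n => ℝ) i).comp
    (chartFrame I θ p y)) = chartForm I (θ i) p := rfl
  rw [h2] at h1
  rw [h1.fderiv]
  simp

/-- A nowhere vanishing Cauchy characteristic vector field annihilated by `τ` produces integral
surfaces on which `τ` does not vanish. -/
lemma HasFrameOn.admitsIntegralSurface {P : CotangentField I M} {n : ℕ} {θ : Fin n → OneForm I M}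
    {V : Set M} (h : HasFrameOn I P n θ V) {X : ∀ p : M, TangentSpace I p}
    (hX : SmoothFieldOn I X V) (hXC : ∀ q ∈ V, IsCauchyVector I P q (X q))
    (hX0 : ∀ q ∈ V, vec X q ≠ 0) {τ : OneForm I M} (hτ : ∀ q ∈ V, SmoothFormAt I τ q)
    (hτX : ∀ q ∈ V, cov I τ q (vec X q) = 0) {p : M} (hp : p ∈ V) (hτP : cov I τ p ∉ fib I P p) :
    AdmitsIntegralSurface I P τ := by
  have hps := mem_extChartAt_source (I := I) p
  let φ := extChartAt I p
  let Ω := φ.target ∩ φ.symm ⁻¹' V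
  have hΩ : IsOpen Ω := isOpen_chart_inter h.isOpen p
  have hpΩ : φ p ∈ Ω := ⟨φ.map_source hps, by simpa [φ, (extChartAt I p).left_inv hps] using hp⟩
  have hΘ : ContDiffOn ℝ ∞ (chartFrame I θ p) Ω := contDiffOn_chartFrame h.smooth p
  let Y : E → E := fun x => tmap I 𝓘(ℝ, E) φ (φ.symm x) (vec X (φ.symm x))
  have hY : ContDiffOn ℝ ∞ Y Ω := SmoothFieldOn.contDiffOn_chart h.isOpen hX p
  have hann : ∀ q ∈ V, ∀ i, cov I (θ i) q (vec X q) = 0 := fun q hq =>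
    (h.annihilates_iff hq _).1 (hXC q hq).1
  have hsrc : ∀ x ∈ Ω, φ.symm x ∈ φ.source := fun x hx => φ.map_target hx.1
  have hinv : ∀ x ∈ Ω, φ (φ.symm x) = x := fun x hx => φ.right_inv hx.1
  have hformY : ∀ (σ : OneForm I M), ∀ x ∈ Ω, chartForm I σ p x (Y x) =
      cov I σ (φ.symm x) (vec X (φ.symm x)) := by
    intro σ x hx
    have := chartForm_tmap σ (hsrc x hx) (vec X (φ.symm x))
    rwa [hinv x hx] at this
  have hsymmY : ∀ x ∈ Ω, tmap 𝓘(ℝ, E) I φ.symm x (Y x) = vec X (φ.symm x) := by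
    intro x hx
    have := tmap_extChartAt_symm_comp (hsrc x hx) (vec X (φ.symm x))
    rwa [hinv x hx] at this
  have hform : ∀ (σ : OneForm I M) (x v), chartForm I σ p x v =
      cov I σ (φ.symm x) (tmap 𝓘(ℝ, E) I φ.symm x v) := fun _ _ _ => rfl
  have hC : ∀ x ∈ Ω, ∀ v, chartFrame I θ p x v = 0 →
      fderiv ℝ (chartFrame I θ p) x (Y x) v - fderiv ℝ (chartFrame I θ p) x v (Y x) = 0 := by
    intro x hx v hv
    have hd : DifferentiableAt ℝ (chartFrame I θ p) x :=
      (hΘ.contDiffAt (hΩ.mem_nhds hx)).differentiableAt (by simp)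
    funext i
    rw [Pi.sub_apply, fderiv_chartFrame θ p hd, fderiv_chartFrame θ p hd, ← extD_apply]
    have h1 := extD_chartForm (hsrc x hx) (h.smooth i _ hx.2) (Y x) v
    rw [hinv x hx, hsymmY x hx] at h1
    rw [h1]
    have h2 : dForm I (θ i) (φ.symm x) (vec X (φ.symm x)) ∈ fib I P (φ.symm x) :=
      (hXC _ hx.2).2 (θ i) V hx.2 (isSectionOn_iff.2 ⟨h.isOpen, h.smooth i, fun q hq =>
        h.cov_mem hq i⟩)
    refine (h.annihilates_iff hx.2 _).2 (fun j => ?_) _ h2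
    rw [← hform]
    exact congrFun hv j
  obtain ⟨u, hu, hτu⟩ : ∃ u : E, (∀ i, cov I (θ i) p u = 0) ∧ cov I τ p u ≠ 0 := by
    by_contra hcon
    push Not at hcon
    refine hτP ?_
    rw [← h.span_eq p hp]
    have := mem_span_of_iInf_ker_le_ker (L := fun i => (cov I (θ i) p).toLinearMap)
      (K := (cov I τ p).toLinearMap) fun u hu => hcon u fun i => (Submodule.mem_iInf _).1 hu i
    rw [Submodule.mem_span_range_iff_exists_fun] at this ⊢
    obtain ⟨c, hc⟩ := this
    refine ⟨c, ?_⟩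
    ext v
    have := LinearMap.congr_fun hc v
    simpa using this
  have hu' : chartFrame I θ p (φ p) u = 0 := funext fun i => by
    rw [chartFrame_apply, chartForm_self]
    exact hu i
  obtain ⟨f, r, hr, hf, hf0, hfu, hfz⟩ := exists_swept_surface hΩ hpΩ hY hΘ
    (chartFrame_surjective hps (h.independent p hp))
    (fun x hx => funext fun i => (hformY (θ i) x hx).trans (hann _ hx.2 i)) hC hu'
  have hfd : ContinuousOn (fderiv ℝ f) (Metric.ball 0 r) :=
    hf.continuousOn_fderiv_of_isOpen Metric.isOpen_ball (by simp)
  have hτΩ : ContinuousOn (chartForm I τ p) Ω := (contDiffOn_chartForm hτ p).continuousOn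
  have hg : ContinuousOn (fun z => chartForm I τ p (f z) (fderiv ℝ f z (1, 0)))
      (Metric.ball 0 r) :=
    (hτΩ.comp hf.continuousOn fun z hz => (hfz z hz).1).clm_apply
      (hfd.clm_apply continuousOn_const)
  obtain ⟨δ, hδ, Hδ⟩ : ∃ δ > 0, ∀ z ∈ Metric.ball (0 : ℝ × ℝ) δ, z ∈ Metric.ball (0 : ℝ × ℝ) r ∧
      chartForm I τ p (f z) (fderiv ℝ f z (1, 0)) ≠ 0 := by
    refine Metric.eventually_nhds_iff_ball.1
      (Filter.Eventually.and (Metric.ball_mem_nhds 0 hr) ?_)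
    refine (hg.continuousAt (Metric.ball_mem_nhds 0 hr)).eventually_ne ?_
    simp only [hf0, hfu]
    have : chartForm I τ p (φ p) = cov I τ p := chartForm_self τ p
    rwa [this]
  obtain ⟨β, hβ, hβz⟩ := exists_diffeomorphism_plane_ball hδ
  have hmem : ∀ s, β s ∈ Metric.ball (0 : ℝ × ℝ) r := fun s => (Hδ _ (hβz s).1).1
  have hfβΩ : ∀ s, f (β s) ∈ Ω := fun s => (hfz _ (hmem s)).1
  have hfat : ∀ s, ContDiffAt ℝ ∞ f (β s) := fun s =>
    hf.contDiffAt (Metric.isOpen_ball.mem_nhds (hmem s))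
  have hφat : ∀ s, ContMDiffAt 𝓘(ℝ, E) I ∞ φ.symm (f (β s)) := fun s =>
    (contMDiffOn_extChartAt_symm p).contMDiffAt
      ((isOpen_extChartAt_target p).mem_nhds (hfβΩ s).1)
  have hfβ : ContDiff ℝ ∞ (fun s => f (β s)) :=
    contDiff_iff_contDiffAt.2 fun s => (hfat s).comp s hβ.contDiffAt
  let j : EuclideanSpace ℝ (Fin 2) → M := fun s => φ.symm (f (β s))
  have hj : ContMDiff (𝓡 2) I ∞ j := fun s =>
    ContMDiffAt.comp s (hφat s) hfβ.contMDiff.contMDiffAt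
  have hdj : ∀ s v, tmap (𝓡 2) I j s v =
      tmap 𝓘(ℝ, E) I φ.symm (f (β s)) (fderiv ℝ f (β s) (fderiv ℝ β s v)) := by
    intro s v
    have h1 := mfderiv_comp s ((hφat s).mdifferentiableAt (by simp))
      (hfβ.contMDiff.contMDiffAt.mdifferentiableAt (x := s) (by simp))
    rw [mfderiv_eq_fderiv] at h1
    have h2 : fderiv ℝ (fun s => f (β s)) s = (fderiv ℝ f (β s)).comp (fderiv ℝ β s) :=
      (((hfat s).differentiableAt (by simp)).hasFDerivAt.comp s
        (hβ.differentiable (by simp) s).hasFDerivAt).fderiv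
    have h3 : tmap (𝓡 2) I j s = (tmap 𝓘(ℝ, E) I φ.symm (f (β s))).comp
      (fderiv ℝ (fun s => f (β s)) s) := h1
    rw [h3, h2]
    rfl
  have hsymm_inj : ∀ s, Function.Injective (tmap 𝓘(ℝ, E) I φ.symm (f (β s))) := by
    intro s
    refine Function.LeftInverse.injective (g := tmap I 𝓘(ℝ, E) φ (φ.symm (f (β s)))) fun v => ?_
    have := tmap_extChartAt_comp_symm (hsrc _ (hfβΩ s)) v
    rwa [hinv _ (hfβΩ s)] at this
  have hfinj : ∀ s, Function.Injective (fderiv ℝ f (β s)) := by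
    intro s
    rw [injective_iff_map_eq_zero]
    rintro ⟨a, b⟩ hab
    obtain ⟨hΩs, hYs, -⟩ := hfz _ (hmem s)
    have e1 : ((a, b) : ℝ × ℝ) = a • (1, 0) + b • (0, 1) := by simp
    rw [e1, map_add, map_smul, map_smul, hYs] at hab
    have e2 := congrArg (chartForm I τ p (f (β s))) hab
    rw [map_add, map_smul, map_smul, hformY τ _ hΩs, hτX _ hΩs.2, smul_zero, add_zero, map_zero,
      smul_eq_mul, mul_eq_zero] at e2
    have ha : a = 0 := e2.resolve_right (Hδ _ (hβz s).1).2
    rw [ha, zero_smul, zero_add, smul_eq_zero] at hab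
    have hb : b = 0 := hab.resolve_right fun hY0 => hX0 _ hΩs.2 (by
      rw [← hsymmY _ hΩs, hY0, map_zero])
    rw [ha, hb]
    rfl
  refine ⟨EuclideanSpace ℝ (Fin 2), inferInstance, inferInstance, inferInstance, inferInstance,
    inferInstance, inferInstance, j, hj, fun s => ⟨?_, ?_, ?_⟩⟩
  · have : Function.Injective (tmap (𝓡 2) I j s) := by
      have h1 : ⇑(tmap (𝓡 2) I j s) = (tmap 𝓘(ℝ, E) I φ.symm (f (β s))) ∘ (fderiv ℝ f (β s)) ∘
        (fderiv ℝ β s) := funext (hdj s)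
      rw [h1]
      exact (hsymm_inj s).comp ((hfinj s).comp (hβz s).2.1)
    exact this
  · have : ∀ α ∈ fib I P (j s), ∀ v, α (tmap (𝓡 2) I j s v) = 0 := by
      intro α hα v
      refine (h.annihilates_iff (hfβΩ s).2 _).2 (fun i => ?_) α hα
      rw [hdj, ← hform]
      have h1 := congrArg (fun l : ℝ × ℝ →L[ℝ] (Fin n → ℝ) => l (fderiv ℝ β s v) i)
        (hfz _ (hmem s)).2.2
      exact h1
    intro α hα
    ext v
    exact this α hα v
  · obtain ⟨v, hv⟩ := (hβz s).2.2 (1, 0)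
    intro h0
    refine (Hδ _ (hβz s).1).2 ?_
    have h1 : cov I τ (j s) (tmap (𝓡 2) I j s v) = 0 :=
      congrArg (fun l : EuclideanSpace ℝ (Fin 2) →L[ℝ] ℝ => l v) h0
    rw [hdj, hv, ← hform] at h1
    exact h1

end IntegralSurface

section ExactForms

variable {E : Type*} [NormedAddCommGroup E] [NormedSpace ℝ E]
  {H : Type*} [TopologicalSpace H] {I : ModelWithCorners ℝ E H}
  {M : Type*} [TopologicalSpace M] [ChartedSpace H M] [IsManifold I ∞ M] [I.Boundaryless]

lemma IsExact.smoothFormAt {τ : OneForm I M} (hτ : IsExact I τ) (q : M) : SmoothFormAt I τ q := by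
  obtain ⟨f, hf, hfτ⟩ := hτ
  have hq := mem_extChartAt_source (I := I) q
  have hf' := contDiffAt_comp_extChartAt_symm hq hf.contMDiffAt
  rw [smoothFormAt_iff hq]
  refine (hf'.fderiv_right (m := ∞) (by simp)).congr_of_eventuallyEq ?_
  filter_upwards [(isOpen_extChartAt_target q).mem_nhds (mem_extChartAt_target (I := I) q)] with x hx
  have d1 : MDifferentiableAt 𝓘(ℝ, E) I (extChartAt I q).symm x := by
    have := mdifferentiableWithinAt_extChartAt_symm (I := I) hx
    rwa [I.range_eq_univ, mdifferentiableWithinAt_univ] at this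
  have h1 := mfderiv_comp x (hf.mdifferentiableAt (x := (extChartAt I q).symm x) (by simp)) d1
  rw [mfderiv_eq_fderiv] at h1
  have h2 : cov I τ ((extChartAt I q).symm x) = tmap I 𝓘(ℝ, ℝ) f ((extChartAt I q).symm x) :=
    hfτ _
  exact (congrArg (fun l : E →L[ℝ] ℝ => l.comp (tmap 𝓘(ℝ, E) I (extChartAt I q).symm x)) h2).trans
    h1.symm

lemma dForm_eq_zero {θ : OneForm I M} (h : ∀ q, cov I θ q = 0) (q : M) : dForm I θ q = 0 := by
  have h1 : chartForm I θ q = fun _ => 0 := by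
    funext x
    ext v
    exact congrArg (fun l : E →L[ℝ] ℝ => l (tmap 𝓘(ℝ, E) I (extChartAt I q).symm x v)) (h _)
  rw [dForm_eq, h1]
  ext v w
  simp [extD_apply]

end ExactForms

section Prolongation

variable {E : Type*} [NormedAddCommGroup E] [NormedSpace ℝ E]
  {M : Type*} [TopologicalSpace M] [ChartedSpace E M]
  {A : Type*} [Fintype A]

lemma tmap_fst (q : M × (A → ℝ)) :
    tmap (prolModel E A) 𝓘(ℝ, E) Prod.fst q = ContinuousLinearMap.fst ℝ E (A → ℝ) := mfderiv_fst

lemma tmap_snd (q : M × (A → ℝ)) :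
    tmap (prolModel E A) 𝓘(ℝ, A → ℝ) Prod.snd q = ContinuousLinearMap.snd ℝ E (A → ℝ) :=
  mfderiv_snd

lemma cov_pullForm (τ : OneForm 𝓘(ℝ, E) M) (q : M × (A → ℝ)) :
    cov (prolModel E A) (pullForm A τ) q =
      (cov 𝓘(ℝ, E) τ q.1).comp (ContinuousLinearMap.fst ℝ E (A → ℝ)) := by
  rw [← tmap_fst q]
  rfl

lemma contMDiffAt_coord (a : A) (q : M × (A → ℝ)) :
    ContMDiffAt (prolModel E A) 𝓘(ℝ, ℝ) ∞ (fun q : M × (A → ℝ) => q.2 a) q :=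
  ((ContinuousLinearMap.proj (R := ℝ) (φ := fun _ : A => ℝ) a).contMDiff.contMDiffAt).comp q
    contMDiffAt_snd

lemma tmap_coord (a : A) (q : M × (A → ℝ)) (ξ : E × (A → ℝ)) :
    tmap (prolModel E A) 𝓘(ℝ, ℝ) (fun q : M × (A → ℝ) => q.2 a) q ξ = ξ.2 a := by
  have h1 := mfderiv_comp (I := prolModel E A) (I' := 𝓘(ℝ, A → ℝ)) (I'' := 𝓘(ℝ, ℝ))
    (g := ContinuousLinearMap.proj (R := ℝ) (φ := fun _ : A => ℝ) a) (f := Prod.snd) q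
    (ContinuousLinearMap.proj (R := ℝ) (φ := fun _ : A => ℝ) a).differentiableAt.mdifferentiableAt
    (contMDiffAt_snd.mdifferentiableAt (n := ∞) (by simp))
  rw [mfderiv_eq_fderiv, ContinuousLinearMap.fderiv] at h1
  have h2 : tmap (prolModel E A) 𝓘(ℝ, ℝ) (fun q : M × (A → ℝ) => q.2 a) q =
    (ContinuousLinearMap.proj (R := ℝ) (φ := fun _ : A => ℝ) a).comp
      (tmap (prolModel E A) 𝓘(ℝ, A → ℝ) Prod.snd q) := h1
  rw [h2, tmap_snd]
  rfl

variable (E A) in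
/-- Pullback of functionals along the projection `E × ℝ^A → E`. -/
def compFst : (E →L[ℝ] ℝ) →ₗ[ℝ] ((E × (A → ℝ)) →L[ℝ] ℝ) where
  toFun β := β.comp (ContinuousLinearMap.fst ℝ E (A → ℝ))
  map_add' _ _ := rfl
  map_smul' _ _ := rfl

omit [Fintype A] in
lemma compFst_injective : Function.Injective (compFst E A) := by
  intro β β' h
  ext v
  exact congrArg (fun l : (E × (A → ℝ)) →L[ℝ] ℝ => l (v, 0)) h

/-- The `1`-form `μ - λ^a τ` on `M × ℝ^A`. -/
def contactForm (τ μ : OneForm 𝓘(ℝ, E) M) (a : A) : OneForm (prolModel E A) (M × (A → ℝ)) :=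
  fun q => pullForm A μ q + (-q.2 a) • pullForm A τ q

lemma cov_contactForm (τ μ : OneForm 𝓘(ℝ, E) M) (a : A) (q : M × (A → ℝ)) :
    cov (prolModel E A) (contactForm τ μ a) q =
      (cov 𝓘(ℝ, E) μ q.1 - q.2 a • cov 𝓘(ℝ, E) τ q.1).comp
        (ContinuousLinearMap.fst ℝ E (A → ℝ)) := by
  have h : cov (prolModel E A) (contactForm τ μ a) q =
    cov (prolModel E A) (pullForm A μ) q + (-q.2 a) • cov (prolModel E A) (pullForm A τ) q := rfl
  rw [h, cov_pullForm, cov_pullForm]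
  ext v <;> simp [sub_eq_add_neg]

lemma fib_partialProlongation (P : CotangentField 𝓘(ℝ, E) M) (τ : OneForm 𝓘(ℝ, E) M)
    (μ : A → OneForm 𝓘(ℝ, E) M) (q : M × (A → ℝ)) :
    fib (prolModel E A) (partialProlongation P τ μ) q =
      (fib 𝓘(ℝ, E) P q.1 ⊔ Submodule.span ℝ
        (range fun a => cov 𝓘(ℝ, E) (μ a) q.1 - q.2 a • cov 𝓘(ℝ, E) τ q.1)).map
        (compFst E A) := by
  have h1 : ∀ α : E →L[ℝ] ℝ, (show (E × (A → ℝ)) →L[ℝ] ℝ from pullCovector A q α) =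
      α.comp (ContinuousLinearMap.fst ℝ E (A → ℝ)) := by
    intro α
    rw [← tmap_fst q]
    rfl
  have h2 : (show (E →L[ℝ] ℝ) →ₗ[ℝ] ((E × (A → ℝ)) →L[ℝ] ℝ) from pullCovector A q) =
      (compFst E A) := LinearMap.ext h1
  rw [Submodule.map_sup, Submodule.map_span, ← range_comp, ← h2]
  have h3 : ((show (E →L[ℝ] ℝ) →ₗ[ℝ] ((E × (A → ℝ)) →L[ℝ] ℝ) from pullCovector A q) ∘
      fun a => cov 𝓘(ℝ, E) (μ a) q.1 - q.2 a • cov 𝓘(ℝ, E) τ q.1) =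
      fun a => cov (prolModel E A) (pullForm A (μ a)) q -
        q.2 a • cov (prolModel E A) (pullForm A τ) q := by
    funext a
    rfl
  rw [h3]
  rfl

lemma mem_fib_partialProlongation {P : CotangentField 𝓘(ℝ, E) M} {τ : OneForm 𝓘(ℝ, E) M}
    {μ : A → OneForm 𝓘(ℝ, E) M} {q : M × (A → ℝ)} {α : (E × (A → ℝ)) →L[ℝ] ℝ} :
    α ∈ fib (prolModel E A) (partialProlongation P τ μ) q ↔
      ∃ β ∈ fib 𝓘(ℝ, E) P q.1 ⊔ Submodule.span ℝ
        (range fun a => cov 𝓘(ℝ, E) (μ a) q.1 - q.2 a • cov 𝓘(ℝ, E) τ q.1),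
        β.comp (ContinuousLinearMap.fst ℝ E (A → ℝ)) = α := by
  rw [fib_partialProlongation]
  exact Submodule.mem_map

lemma contactForm_mem (P : CotangentField 𝓘(ℝ, E) M) (τ : OneForm 𝓘(ℝ, E) M)
    (μ : A → OneForm 𝓘(ℝ, E) M) (a : A) (q : M × (A → ℝ)) :
    cov (prolModel E A) (contactForm τ (μ a) a) q ∈
      fib (prolModel E A) (partialProlongation P τ μ) q :=
  mem_fib_partialProlongation.2 ⟨_, Submodule.mem_sup_right (Submodule.subset_span ⟨a, rfl⟩),
    (cov_contactForm τ (μ a) a q).symm⟩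

lemma pullForm_mem {P : CotangentField 𝓘(ℝ, E) M} (τ : OneForm 𝓘(ℝ, E) M)
    (μ : A → OneForm 𝓘(ℝ, E) M) {σ : OneForm 𝓘(ℝ, E) M} {q : M × (A → ℝ)}
    (hσ : cov 𝓘(ℝ, E) σ q.1 ∈ fib 𝓘(ℝ, E) P q.1) :
    cov (prolModel E A) (pullForm A σ) q ∈
      fib (prolModel E A) (partialProlongation P τ μ) q :=
  mem_fib_partialProlongation.2 ⟨_, Submodule.mem_sup_left hσ, (cov_pullForm σ q).symm⟩

/-- Independence of a family modulo `p` and `t`, spelled out. -/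
lemma coeff_eq_zero_of_independent_mkQ {V : Type*} [AddCommGroup V] [Module ℝ V]
    {p : Submodule ℝ V} {t : V} {m : A → V}
    (h : LinearIndependent ℝ fun a => (p ⊔ Submodule.span ℝ {t}).mkQ (m a)) {c : A → ℝ} {x : V}
    {s : ℝ} (hx : x ∈ p) (h0 : x + s • t + ∑ a, c a • m a = 0) (a : A) : c a = 0 := by
  refine Fintype.linearIndependent_iff.1 h c ?_ a
  have h1 : (p ⊔ Submodule.span ℝ {t}).mkQ (x + s • t) = 0 :=
    (Submodule.Quotient.mk_eq_zero _).2 (add_mem (Submodule.mem_sup_left hx)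
      (Submodule.mem_sup_right (Submodule.smul_mem _ _ (Submodule.mem_span_singleton_self t))))
  have h2 := congrArg (p ⊔ Submodule.span ℝ {t}).mkQ h0
  rw [map_add, h1, zero_add, map_zero, map_sum] at h2
  simpa only [map_smul] using h2

/-- `τ` is not in the system generated by `P` and the `μ^a - λ^a τ`. -/
lemma pullForm_notMem {P : CotangentField 𝓘(ℝ, E) M} {τ : OneForm 𝓘(ℝ, E) M}
    {μ : A → OneForm 𝓘(ℝ, E) M} (hτ : ∀ p, cov 𝓘(ℝ, E) τ p ∉ fib 𝓘(ℝ, E) P p)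
    (hind : IndependentModulo P τ μ) (q : M × (A → ℝ)) :
    cov (prolModel E A) (pullForm A τ) q ∉
      fib (prolModel E A) (partialProlongation P τ μ) q := by
  intro h
  obtain ⟨β, hβ, hβτ⟩ := mem_fib_partialProlongation.1 h
  rw [cov_pullForm] at hβτ
  obtain rfl := compFst_injective hβτ
  obtain ⟨x, hx, y, hy, hxy⟩ := Submodule.mem_sup.1 hβ
  rw [Submodule.mem_span_range_iff_exists_fun] at hy
  obtain ⟨c, rfl⟩ := hy
  have hi : LinearIndependent ℝ fun a => (fib 𝓘(ℝ, E) P q.1 ⊔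
    Submodule.span ℝ {cov 𝓘(ℝ, E) τ q.1}).mkQ (cov 𝓘(ℝ, E) (μ a) q.1) := hind q.1
  have hc := coeff_eq_zero_of_independent_mkQ (s := -∑ a, c a * q.2 a - 1) hi hx (c := c) (by
    rw [← sub_eq_zero] at hxy
    rw [← hxy]
    simp only [smul_sub, Finset.sum_sub_distrib, smul_smul, ← Finset.sum_smul, sub_smul, neg_smul,
      one_smul]
    abel)
  simp only [hc, zero_smul, Finset.sum_const_zero, add_zero] at hxy
  exact hτ q.1 (hxy ▸ hx)

variable [IsManifold 𝓘(ℝ, E) ∞ M]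

lemma smoothFormAt_pullForm {σ : OneForm 𝓘(ℝ, E) M} {q : M × (A → ℝ)}
    (hσ : SmoothFormAt 𝓘(ℝ, E) σ q.1) : SmoothFormAt (prolModel E A) (pullForm A σ) q :=
  smoothFormAt_pullbackForm (I' := prolModel E A) (g := Prod.fst) contMDiffAt_fst hσ

lemma dForm_pullForm {σ : OneForm 𝓘(ℝ, E) M} {q : M × (A → ℝ)}
    (hσ : SmoothFormAt 𝓘(ℝ, E) σ q.1) (ξ ζ : E × (A → ℝ)) :
    dForm (prolModel E A) (pullForm A σ) q ξ ζ = dForm 𝓘(ℝ, E) σ q.1 ξ.1 ζ.1 := by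
  have := dForm_pullbackForm (I' := prolModel E A) (g := Prod.fst) (q := q) contMDiffAt_fst hσ ξ ζ
  rwa [tmap_fst] at this

lemma smoothFormAt_contactForm {τ μ : OneForm 𝓘(ℝ, E) M} (a : A) {q : M × (A → ℝ)}
    (hτ : SmoothFormAt 𝓘(ℝ, E) τ q.1) (hμ : SmoothFormAt 𝓘(ℝ, E) μ q.1) :
    SmoothFormAt (prolModel E A) (contactForm τ μ a) q :=
  (smoothFormAt_pullForm hμ).add ((smoothFormAt_pullForm hτ).smul (contMDiffAt_coord a q).neg)

lemma dForm_contactForm_vertical {τ μ : OneForm 𝓘(ℝ, E) M} (a : A) {q : M × (A → ℝ)}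
    (hτ : SmoothFormAt 𝓘(ℝ, E) τ q.1) (hμ : SmoothFormAt 𝓘(ℝ, E) μ q.1) (ξ : E × (A → ℝ))
    (w : A → ℝ) :
    dForm (prolModel E A) (contactForm τ μ a) q ξ (0, w) = w a * cov 𝓘(ℝ, E) τ q.1 ξ.1 := by
  have hn : ContMDiffAt (prolModel E A) 𝓘(ℝ, ℝ) ∞ (fun q : M × (A → ℝ) => -q.2 a) q :=
    (contMDiffAt_coord a q).neg
  have ht : ∀ ζ : E × (A → ℝ), tmap (prolModel E A) 𝓘(ℝ, ℝ) (fun q : M × (A → ℝ) => -q.2 a) q ζ =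
      -ζ.2 a := by
    intro ζ
    have h1 : tmap (prolModel E A) 𝓘(ℝ, ℝ) (fun q : M × (A → ℝ) => -q.2 a) q =
      -tmap (prolModel E A) 𝓘(ℝ, ℝ) (fun q : M × (A → ℝ) => q.2 a) q := mfderiv_neg
    rw [h1, neg_apply, tmap_coord]
  have h1 : dForm (prolModel E A) (contactForm τ μ a) q =
      dForm (prolModel E A) (pullForm A μ) q +
        dForm (prolModel E A) (fun q => (-q.2 a) • pullForm A τ q) q :=
    dForm_add (smoothFormAt_pullForm hμ) ((smoothFormAt_pullForm hτ).smul hn)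
  rw [h1, add_apply, add_apply, dForm_smul hn (smoothFormAt_pullForm hτ), dForm_pullForm hμ,
    dForm_pullForm hτ, ht, ht, cov_pullForm]
  simp

/-- The frame of the prolongation obtained from a frame of the system. -/
def prolFrame {n : ℕ} (θ : Fin n → OneForm 𝓘(ℝ, E) M) (τ : OneForm 𝓘(ℝ, E) M)
    (μ : A → OneForm 𝓘(ℝ, E) M) (i : Fin (n + Fintype.card A)) :
    OneForm (prolModel E A) (M × (A → ℝ)) :=
  Sum.elim (fun k => pullForm A (θ k))
    (fun k => contactForm τ (μ ((Fintype.equivFin A).symm k)) ((Fintype.equivFin A).symm k))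
    (finSumFinEquiv.symm i)

lemma HasFrameOn.partialProlongation {n : ℕ} {P : CotangentField 𝓘(ℝ, E) M}
    {θ : Fin n → OneForm 𝓘(ℝ, E) M} {V : Set M} (h : HasFrameOn 𝓘(ℝ, E) P n θ V)
    {τ : OneForm 𝓘(ℝ, E) M} {μ : A → OneForm 𝓘(ℝ, E) M}
    (hτ : ∀ p, SmoothFormAt 𝓘(ℝ, E) τ p) (hμ : ∀ a p, SmoothFormAt 𝓘(ℝ, E) (μ a) p)
    (hind : IndependentModulo P τ μ) :
    HasFrameOn (prolModel E A) (partialProlongation P τ μ) (n + Fintype.card A)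
      (prolFrame θ τ μ) (Prod.fst ⁻¹' V) := by
  have hcov : ∀ q : M × (A → ℝ), (fun i => cov (prolModel E A) (prolFrame θ τ μ i) q) =
      compFst E A ∘
      (Sum.elim (fun k => cov 𝓘(ℝ, E) (θ k) q.1)
        fun a => cov 𝓘(ℝ, E) (μ a) q.1 - q.2 a • cov 𝓘(ℝ, E) τ q.1) ∘
      (finSumFinEquiv.symm.trans (Equiv.sumCongr (Equiv.refl _) (Fintype.equivFin A).symm)) := by
    intro q
    funext i
    obtain ⟨k, rfl⟩ := finSumFinEquiv.surjective i
    rcases k with k | k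
    · simp only [prolFrame, Equiv.symm_apply_apply, Function.comp_apply, Equiv.trans_apply]
      exact cov_pullForm _ _
    · simp only [prolFrame, Equiv.symm_apply_apply, Function.comp_apply, Equiv.trans_apply]
      exact cov_contactForm _ _ _ _
  refine ⟨h.isOpen.preimage continuous_fst, fun i q hq => ?_, fun q hq => ?_, fun q hq => ?_⟩
  · obtain ⟨k, rfl⟩ := finSumFinEquiv.surjective i
    rcases k with k | k
    · simp only [prolFrame, Equiv.symm_apply_apply]
      exact smoothFormAt_pullForm (h.smooth k q.1 hq)
    · simp only [prolFrame, Equiv.symm_apply_apply]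
      exact smoothFormAt_contactForm _ (hτ _) (hμ _ _)
  · rw [hcov]
    refine LinearIndependent.map' ?_ (compFst E A) (LinearMap.ker_eq_bot.2 compFst_injective)
    refine (linearIndependent_equiv _).2 (Fintype.linearIndependent_iff.2 fun g hg => ?_)
    rw [Fintype.sum_sum_type] at hg
    simp only [Sum.elim_inl, Sum.elim_inr] at hg
    have hi : LinearIndependent ℝ fun a => (fib 𝓘(ℝ, E) P q.1 ⊔
      Submodule.span ℝ {cov 𝓘(ℝ, E) τ q.1}).mkQ (cov 𝓘(ℝ, E) (μ a) q.1) := hind q.1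
    have hc := coeff_eq_zero_of_independent_mkQ (s := -∑ a, g (Sum.inr a) * q.2 a) hi
      (x := ∑ k, g (Sum.inl k) • cov 𝓘(ℝ, E) (θ k) q.1) (c := fun a => g (Sum.inr a))
      (Submodule.sum_mem _ fun k _ => Submodule.smul_mem _ _ (h.cov_mem hq k)) (by
        rw [← hg]
        simp only [smul_sub, Finset.sum_sub_distrib, smul_smul, ← Finset.sum_smul, neg_smul]
        abel)
    simp only [hc, zero_smul, Finset.sum_const_zero, add_zero] at hg
    have hd := Fintype.linearIndependent_iff.1 (h.independent q.1 hq) _ hg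
    rintro (k | a)
    exacts [hd k, hc a]
  · rw [hcov, range_comp, (Equiv.surjective _).range_comp, fib_partialProlongation, ← h.span_eq _ hq,
      Sum.elim_range, ← Submodule.span_union, Submodule.map_span]

end Prolongation

section ProlongationSystem

variable {E : Type*} [NormedAddCommGroup E] [NormedSpace ℝ E]
  {M : Type*} [TopologicalSpace M] [ChartedSpace E M] [IsManifold 𝓘(ℝ, E) ∞ M]
  {A : Type*} [Fintype A]

omit [IsManifold 𝓘(ℝ, E) ∞ M] in
lemma IsExact.pullForm {τ : OneForm 𝓘(ℝ, E) M} (h : IsExact 𝓘(ℝ, E) τ) :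
    IsExact (prolModel E A) (pullForm A τ) := by
  obtain ⟨f, hf, hfτ⟩ := h
  refine ⟨fun q => f q.1, hf.comp contMDiff_fst, fun q => ?_⟩
  have h1 := mfderiv_comp (I := prolModel E A) (I' := 𝓘(ℝ, E)) (I'' := 𝓘(ℝ, ℝ)) (f := Prod.fst) q
    (hf.mdifferentiableAt (x := q.1) (by simp))
    (contMDiffAt_fst.mdifferentiableAt (n := ∞) (by simp))
  have h2 : cov 𝓘(ℝ, E) τ q.1 = tmap 𝓘(ℝ, E) 𝓘(ℝ, ℝ) f q.1 := hfτ _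
  exact (congrArg (fun l : E →L[ℝ] ℝ => l.comp (tmap (prolModel E A) 𝓘(ℝ, E) Prod.fst q)) h2).trans
    h1.symm

/-- An integral surface of a partial prolongation projects to an integral surface. -/
lemma AdmitsIntegralSurface.of_partialProlongation {P : CotangentField 𝓘(ℝ, E) M}
    {τ : OneForm 𝓘(ℝ, E) M} {μ : A → OneForm 𝓘(ℝ, E) M}
    (hτ : ∀ p, SmoothFormAt 𝓘(ℝ, E) τ p) (hμ : ∀ a p, SmoothFormAt 𝓘(ℝ, E) (μ a) p)
    (h : AdmitsIntegralSurface (prolModel E A) (partialProlongation P τ μ) (pullForm A τ)) :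
    AdmitsIntegralSurface 𝓘(ℝ, E) P τ := by
  obtain ⟨S, iS₁, iS₂, iS₃, iS₄, iS₅, iS₆, j, hj, hS⟩ := h
  have hd : ∀ s, tmap (𝓡 2) 𝓘(ℝ, E) (fun s => (j s).1) s =
      (ContinuousLinearMap.fst ℝ E (A → ℝ)).comp (tmap (𝓡 2) (prolModel E A) j s) := by
    intro s
    have h1 := mfderiv_comp (I := 𝓡 2) (I' := prolModel E A) (I'' := 𝓘(ℝ, E)) (g := Prod.fst) s
      (contMDiffAt_fst.mdifferentiableAt (n := ∞) (by simp))
      (hj.mdifferentiableAt (x := s) (by simp))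
    rw [← tmap_fst (j s)]
    exact h1
  have hτS : ∀ s, ∃ u, cov 𝓘(ℝ, E) τ (j s).1 (tmap (𝓡 2) (prolModel E A) j s u).1 ≠ 0 := by
    intro s
    by_contra hcon
    push Not at hcon
    refine (hS s).2.2 ?_
    ext u
    have h1 : cov (prolModel E A) (pullForm A τ) (j s) (tmap (𝓡 2) (prolModel E A) j s u) = 0 := by
      rw [cov_pullForm]
      exact hcon u
    exact h1
  have hzero : ∀ a s, cov (𝓡 2) (pullbackForm (𝓡 2) j (contactForm τ (μ a) a)) s = 0 :=
    fun a s => (hS s).2.1 _ (contactForm_mem P τ μ a (j s))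
  refine ⟨S, iS₁, iS₂, iS₃, iS₄, iS₅, iS₆, fun s => (j s).1, contMDiff_fst.comp hj,
    fun s => ⟨?_, ?_, ?_⟩⟩
  · have : Function.Injective (tmap (𝓡 2) 𝓘(ℝ, E) (fun s => (j s).1) s) := by
      rw [injective_iff_map_eq_zero]
      intro v hv
      rw [hd] at hv
      obtain ⟨u, hu⟩ := hτS s
      have hw : tmap (𝓡 2) (prolModel E A) j s v = (0, (tmap (𝓡 2) (prolModel E A) j s v).2) :=
        Prod.ext hv rfl
      have hw0 : (tmap (𝓡 2) (prolModel E A) j s v).2 = 0 := by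
        funext a
        have h1 := dForm_pullbackForm (hj s)
          (smoothFormAt_contactForm (q := j s) a (hτ _) (hμ a _)) u v
        rw [hw, dForm_contactForm_vertical a (hτ _) (hμ a _), dForm_eq_zero (hzero a)] at h1
        exact (mul_eq_zero.1 h1.symm).resolve_right hu
      have hinj : Function.Injective (tmap (𝓡 2) (prolModel E A) j s) := (hS s).1
      refine hinj ?_
      rw [hw, hw0, map_zero]
      rfl
    exact this
  · have : ∀ α ∈ fib 𝓘(ℝ, E) P (j s).1,
        α.comp (tmap (𝓡 2) 𝓘(ℝ, E) (fun s => (j s).1) s) = 0 := by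
      intro α hα
      have h1 : (compFst E A α).comp (tmap (𝓡 2) (prolModel E A) j s) = 0 :=
        (hS s).2.1 _ (mem_fib_partialProlongation.2 ⟨α, Submodule.mem_sup_left hα, rfl⟩)
      rw [hd]
      exact h1
    exact this
  · obtain ⟨u, hu⟩ := hτS s
    intro h0
    have h1 : (cov 𝓘(ℝ, E) τ (j s).1).comp (tmap (𝓡 2) 𝓘(ℝ, E) (fun s => (j s).1) s) = 0 := h0
    rw [hd] at h1
    exact hu (congrArg (fun l : EuclideanSpace ℝ (Fin 2) →L[ℝ] ℝ => l u) h1)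

/-- Cauchy characteristic vectors of a prolongation by at least one form annihilate `τ`. -/
lemma IsCauchyVector.cov_eq_zero [Nonempty A] {P : CotangentField 𝓘(ℝ, E) M}
    {τ : OneForm 𝓘(ℝ, E) M} {μ : A → OneForm 𝓘(ℝ, E) M}
    (hτ : ∀ p, SmoothFormAt 𝓘(ℝ, E) τ p) (hμ : ∀ a p, SmoothFormAt 𝓘(ℝ, E) (μ a) p)
    {q : M × (A → ℝ)} {ξ : E × (A → ℝ)}
    (h : IsCauchyVector (prolModel E A) (partialProlongation P τ μ) q ξ) :
    cov (prolModel E A) (pullForm A τ) q ξ = 0 := by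
  classical
  obtain ⟨a⟩ := ‹Nonempty A›
  have h1 : dForm (prolModel E A) (contactForm τ (μ a) a) q ξ ∈
      fib (prolModel E A) (partialProlongation P τ μ) q :=
    h.2 (contactForm τ (μ a) a) univ (mem_univ q) (isSectionOn_iff.2 ⟨isOpen_univ,
      fun q _ => smoothFormAt_contactForm a (hτ _) (hμ a _),
      fun q _ => contactForm_mem P τ μ a q⟩)
  obtain ⟨β, -, hβ⟩ := mem_fib_partialProlongation.1 h1
  have h2 := congrArg (fun l : (E × (A → ℝ)) →L[ℝ] ℝ => l (0, Pi.single a 1)) hβ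
  simp only [dForm_contactForm_vertical a (hτ _) (hμ a _), ContinuousLinearMap.comp_apply,
    Pi.single_eq_same, one_mul] at h2
  rw [cov_pullForm]
  exact h2.symm.trans (map_zero β)

/-- A partial prolongation by no forms has no new Cauchy characteristics. -/
lemma AdmitsCauchyCharacteristics.of_partialProlongation [IsEmpty A]
    {P : CotangentField 𝓘(ℝ, E) M} {τ : OneForm 𝓘(ℝ, E) M} {μ : A → OneForm 𝓘(ℝ, E) M}
    (h : AdmitsCauchyCharacteristics (prolModel E A) (partialProlongation P τ μ)) :
    AdmitsCauchyCharacteristics 𝓘(ℝ, E) P := by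
  obtain ⟨U, X, hU, ⟨⟨p₀, w₀⟩, hp₀⟩, hX, hXU⟩ := h
  have hcont : ContMDiff 𝓘(ℝ, E) (prolModel E A) ∞ (fun p : M => ((p, 0) : M × (A → ℝ))) :=
    contMDiff_id.prodMk contMDiff_const
  have hmem : ∀ {α : E →L[ℝ] ℝ} {p : M},
      compFst E A α ∈ fib (prolModel E A) (partialProlongation P τ μ) (p, 0) ↔
        α ∈ fib 𝓘(ℝ, E) P p := by
    intro α p
    rw [mem_fib_partialProlongation]
    simp only [range_eq_empty, Submodule.span_empty, sup_bot_eq]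
    exact ⟨fun ⟨β, hβ, h⟩ => compFst_injective h ▸ hβ, fun h => ⟨α, h, rfl⟩⟩
  let Y : ∀ p : M, TangentSpace 𝓘(ℝ, E) p := fun p => (vec X (p, (0 : A → ℝ))).1
  have hXY : ∀ p, vec X (p, (0 : A → ℝ)) = (Y p, 0) := fun p =>
    Prod.ext rfl (Subsingleton.elim _ _)
  refine ⟨(fun p : M => ((p, 0) : M × (A → ℝ))) ⁻¹' U, Y, hU.preimage hcont.continuous,
    ⟨p₀, ?_⟩, ?_, fun p hp => ⟨?_, ?_, ?_⟩⟩
  · rwa [mem_preimage, Subsingleton.elim 0 w₀]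
  · have h1 : ContMDiff (prolModel E A).tangent 𝓘(ℝ, E).tangent ∞
        (tangentMap (prolModel E A) 𝓘(ℝ, E) (Prod.fst : M × (A → ℝ) → M)) :=
      contMDiff_fst.contMDiff_tangentMap (m := ∞) (n := ∞) (by simp)
    have h2 := h1.comp_contMDiffOn (hX.comp hcont.contMDiffOn
      (s := (fun p : M => ((p, 0) : M × (A → ℝ))) ⁻¹' U) fun p hp => hp)
    refine h2.congr fun p hp => ?_
    have h3 : (vec X (p, (0 : A → ℝ))).1 = tmap (prolModel E A) 𝓘(ℝ, E)
        (Prod.fst : M × (A → ℝ) → M) (p, 0) (vec X (p, (0 : A → ℝ))) := by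
      rw [tmap_fst]
      rfl
    exact congrArg (fun v : E => (⟨p, v⟩ : TangentBundle 𝓘(ℝ, E) M)) h3
  · intro h0
    refine (hXU _ hp).1 ?_
    have h1 : vec X (p, (0 : A → ℝ)) = 0 := by
      rw [hXY p]
      exact Prod.ext h0 rfl
    exact h1
  · intro α hα
    have h1 : compFst E A α (vec X (p, (0 : A → ℝ))) = 0 := (hXU _ hp).2.1 _ (hmem.2 hα)
    exact h1
  · intro σ W hpW hσ
    obtain ⟨hW, hσ₁, hσ₂⟩ := isSectionOn_iff.1 hσ
    have h1 : dForm (prolModel E A) (pullForm A σ) (p, 0) (vec X (p, (0 : A → ℝ))) ∈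
        fib (prolModel E A) (partialProlongation P τ μ) (p, 0) :=
      (hXU _ hp).2.2 (pullForm A σ) (Prod.fst ⁻¹' W) hpW (isSectionOn_iff.2
        ⟨hW.preimage continuous_fst, fun q hq => smoothFormAt_pullForm (hσ₁ _ hq),
          fun q hq => pullForm_mem τ μ (hσ₂ _ hq)⟩)
    have h2 : dForm (prolModel E A) (pullForm A σ) (p, 0) (vec X (p, (0 : A → ℝ))) =
        compFst E A (dForm 𝓘(ℝ, E) σ p (Y p)) := by
      refine ContinuousLinearMap.ext fun ζ => ?_
      exact dForm_pullForm (hσ₁ p hpW) _ ζ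
    rw [h2, hmem] at h1
    exact h1

end ProlongationSystem

end PfaffianSystem

end

theorem mainTheorem12
    {E : Type*} [NormedAddCommGroup E] [NormedSpace ℝ E] [FiniteDimensional ℝ E]
    {M : Type*} [TopologicalSpace M] [ChartedSpace E M] [IsManifold 𝓘(ℝ, E) ∞ M]
    [T2Space M] [SecondCountableTopology M]
    {A : Type*} [Fintype A] (n : ℕ)
    (P : PfaffianSystem.CotangentField 𝓘(ℝ, E) M) (τ : PfaffianSystem.OneForm 𝓘(ℝ, E) M)
    (hsys : PfaffianSystem.IsSystem 𝓘(ℝ, E) P n τ)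
    (μ : A → PfaffianSystem.OneForm 𝓘(ℝ, E) M)
    (hμ : ∀ a, PfaffianSystem.SmoothFormOn 𝓘(ℝ, E) (μ a) Set.univ)
    (hind : PfaffianSystem.IndependentModulo P τ μ) :
    PfaffianSystem.IsSystem (PfaffianSystem.prolModel E A)
      (PfaffianSystem.partialProlongation P τ μ) (n + Fintype.card A)
      (PfaffianSystem.pullForm A τ) ∧
    ∀ V : Set (M × (A → ℝ)), IsOpen V → V.Nonempty →
      ∃ U ⊆ V, IsOpen U ∧ U.Nonempty ∧
        PfaffianSystem.HasConstantDerivedRanksOn (PfaffianSystem.prolModel E A)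
          (PfaffianSystem.partialProlongation P τ μ) U := by
  have hτ := fun p => hsys.exact.smoothFormAt p
  have hμ' : ∀ a p, PfaffianSystem.SmoothFormAt 𝓘(ℝ, E) (μ a) p := fun a p =>
    (PfaffianSystem.smoothFormOn_iff isOpen_univ).1 (hμ a) p (mem_univ p)
  have hτP := PfaffianSystem.pullForm_notMem hsys.independence hind
  have hframe : ∀ q : M × (A → ℝ), ∃ V, q ∈ V ∧ ∃ θ, PfaffianSystem.HasFrameOn
      (PfaffianSystem.prolModel E A) (PfaffianSystem.partialProlongation P τ μ)
      (n + Fintype.card A) θ V := by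
    intro q
    obtain ⟨V, hqV, θ, hθ⟩ := PfaffianSystem.isSubbundle_iff.1 hsys.subbundle q.1
    exact ⟨Prod.fst ⁻¹' V, hqV, _, hθ.partialProlongation hτ hμ' hind⟩
  have hsurf : ¬ PfaffianSystem.AdmitsIntegralSurface (PfaffianSystem.prolModel E A)
      (PfaffianSystem.partialProlongation P τ μ) (PfaffianSystem.pullForm A τ) := fun h =>
    hsys.no_surface (h.of_partialProlongation hτ hμ')
  refine ⟨⟨PfaffianSystem.isSubbundle_iff.2 hframe, hτP, ?_, hsys.exact.pullForm, hsurf⟩, ?_⟩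
  · intro h
    rcases isEmpty_or_nonempty A with hA | hA
    · exact hsys.no_cauchy h.of_partialProlongation
    · obtain ⟨U, X, hU, ⟨q, hq⟩, hX, hXU⟩ := h
      obtain ⟨V, hqV, θ, hθ⟩ := hframe q
      refine hsurf ((hθ.mono (hθ.isOpen.inter hU) inter_subset_left).admitsIntegralSurface
        (X := X) (ContMDiffOn.mono hX inter_subset_right) (fun y hy => (hXU y hy.2).2)
        (fun y hy => (hXU y hy.2).1)
        (fun y _ => PfaffianSystem.smoothFormAt_pullForm (hτ _))
        (fun y hy => (hXU y hy.2).2.cov_eq_zero hτ hμ') ⟨hqV, hq⟩ (hτP q))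
  · rintro V hV ⟨q, hq⟩
    obtain ⟨W, hqW, θ, hθ⟩ := hframe q
    obtain ⟨U, hUV, hU, hUn, h⟩ :=
      (hθ.mono (hθ.isOpen.inter hV) inter_subset_left).exists_hasConstantDerivedRanksOn _
        ⟨q, hqW, hq⟩
    exact ⟨U, hUV.trans inter_subset_right, hU, hUn, h⟩
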